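/- **Theorem (Lower bound on $P_{\mathsf{suc}}$).** Let $q$ be a prime power and let $m,s\ge 1$, $n\ge 0$, $d\ge1$ and $0\le t<d$ be integers. Let $\boldsymbol\alpha=(\alpha_1,\dots,\alpha_n)$ be distinct nonzero elements of $\mathbb F_{q^m}$ and $\boldsymbol v\in(\mathbb F_{q^m}^*)^n$. Put $\boldsymbol H_{\boldsymbol v}=(v_j\alpha_j^{\,i-1})_{1\le i\le d-1,\,1\le j\le n}$, and let $\mathcal C=\{\boldsymbol c\in\mathbb F_q^n : \boldsymbol H_{\boldsymbol v}\boldsymbol c^\top=\boldsymbol 0\}$ be the corresponding alternant code, i.e. the $\mathbb F_q$-subfield subcode of the generalized Reed–Solomon code with parity-check matrix $\boldsymbol H_{\boldsymbol v}$. Let $\mathcal{IC}^{(s)}$ be the set of $s\times n$ matrices over $\mathbb F_q$ all of whose rows lie in $\mathcal C$. *Decoder.* On input $\boldsymbol R\in\mathbb F_{q^m}^{s\times n}$ compute the syndromes $(s_{i,\ell})=\boldsymbol R\boldsymbol H_{\boldsymbol v}^\top$ $(1\le i\le s,\ 1\le \ell\le d-1)$. If they are all zero, return $\boldsymbol R$.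 Otherwise let $\tau$ be the least integer $\ge0$ for which the linear system $$s_{i,r+\tau}+\Lambda_1 s_{i,r+\tau-1}+\dots+\Lambda_\tau s_{i,r}=0\qquad(1\le i\le s,\ 1\le r\le d-1-\tau)$$ in the unknowns $\Lambda_1,\dots,\Lambda_\tau\in\mathbb F_{q^m}$ is solvable. If the solution is not unique, or if $\Lambda(x)=1+\Lambda_1x+\dots+\Lambda_\tau x^\tau$ does not have exactly $\tau$ distinct roots in $\mathbb F_{q^m}$, declare a decoding failure. Otherwise return $\boldsymbol R-\hat{\boldsymbol E}$, where $\hat{\boldsymbol E}$ is given by Forney's formula: $\hat E_{i,j}=-\frac{\alpha_j}{v_j}\,\frac{\Omega_i(\alpha_j^{-1})}{\Lambda'(\alpha_j^{-1})}$ if $\Lambda(\alpha_j^{-1})=0$, and $\hat E_{i,j}=0$ otherwise, with $\Omega_i(x)=\big(\sum_{\ell=1}^{d-1}s_{i,\ell}x^{\ell-1}\big)\Lambda(x)\bmod x^{d-1}$. *Channel.* Let $\mathcal E\subseteq\{1,\dots,n\}$ with $|\mathcal E|=t$ and $\boldsymbol C\in\mathcal{IC}^{(s)}$. Let $\widetilde{\boldsymbol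 E}\in\mathbb F_q^{s\times n}$ be zero outside the columns in $\mathcal E$, with $\widetilde{\boldsymbol E}|_{\mathcal E}$ uniformly distributed over the $s\times t$ matrices over $\mathbb F_q$ without zero columns. Let $P_{\mathsf{suc}}(\mathcal{IC}^{(s)},\mathcal E)$ be the probability that the decoder, applied to $\boldsymbol C+\widetilde{\boldsymbol E}$, returns $\boldsymbol C$. *Constants.* For $1\le\delta\le i\le w$ put $$B^{\mathsf{MDS}}_{w,\delta,i}=(q^m-1)^{w-i}(q-1)^i\binom{w}{i}\sum_{j=0}^{i-\delta}(-1)^j\binom ij\big(q^{m(i-\delta+1-j)}-1\big),\qquad B^{\mathsf{MDS}}_{w,\delta}=(q^m-1)^w+\sum_{i=\delta}^w B^{\mathsf{MDS}}_{w,\delta,i}.$$ For $d-t\le w\le t$ let $k_q^{\mathsf{opt}}(w,d-t)$ be any real upper bound on the dimension of the linear codes over $\mathbb F_q$ of length $w$ and minimum Hamming distance $d-t$, and put $$a_w=\max\{1,q^{\,w-(d-t-1)m}\},\qquad b_w=q^{\,k_q^{\mathsf{opt}}(w,d-t)},\qquad c_w=(q^m-1)^w .$$ Then: 1. For $d-t\le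 w\le t$ and every linear MDS code $\mathcal D\subseteq\mathbb F_{q^m}^w$ of minimum distance $d-t$, and every $i$ with $d-t\le i\le w$, $$B^{\mathsf{MDS}}_{w,d-t,i}=\sum_{\boldsymbol u\in(\mathbb F_{q^m}^*)^w}\big|\{\boldsymbol c\,\mathrm{diag}(\boldsymbol u):\boldsymbol c\in\mathcal D,\ \mathrm{wt}(\boldsymbol c)=i\}\cap\mathbb F_q^w\big|,\qquad B^{\mathsf{MDS}}_{w,d-t}=\sum_{\boldsymbol u\in(\mathbb F_{q^m}^*)^w}\big|\{\boldsymbol c\,\mathrm{diag}(\boldsymbol u):\boldsymbol c\in\mathcal D\}\cap\mathbb F_q^w\big|.$$ 2. For every codeword $\boldsymbol C\in\mathcal{IC}^{(s)}$ that is sent, $$P_{\mathsf{suc}}(\mathcal{IC}^{(s)},\mathcal E)\ \ge\ 1-\sum_{w=d-t}^{t}\frac{\binom tw}{(q^m-1)(q^s-1)^w}\Bigg(\frac{q^s-1}{q-1}\Big(c_w+B^{\mathsf{MDS}}_{w,d-t,w}-B^{\mathsf{MDS}}_{w,d-t}\Big)-c_w+\Big(\frac{B^{\mathsf{MDS}}_{w,d-t}-c_wa_w}{b_w-a_w}+1\Big)(b_w^s-a_w^s)+c_wa_w^s\Bigg).$$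 Here the fraction with denominator $b_w-a_w$ is read as $0$ if $b_w=a_w$ (its factor $b_w^s-a_w^s$ is then $0$), and the sum is $0$ if $d-t>t$. -/

import Mathlib

open Polynomial

noncomputable section

namespace IntAlt

/-! ### Generalized Reed-Solomon codes and alternant codes -/

/-- The `r × n` matrix with rows `(α_j ^ i)_j`, `i = 0, …, r - 1`. -/
def locatorMatrix {ι K : Type*} [Field K] (α : ι → K) (r : ℕ) : Matrix (Fin r) ι K :=
  Matrix.of fun i j => α j ^ (i : ℕ)

/-- The parity-check matrix `H · diag(v)` of the GRS code of designed distance `d` with code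
locators `α` and column multipliers `v`; it has `d - 1` rows. -/
def grsParityCheck {ι K : Type*} [Field K] [Fintype ι] [DecidableEq ι]
    (α v : ι → K) (d : ℕ) : Matrix (Fin (d - 1)) ι K :=
  locatorMatrix α (d - 1) * Matrix.diagonal v

/-- The GRS code `{c ∈ K^n | H · diag(v) · c = 0}`. -/
def grsCode {ι K : Type*} [Field K] [Fintype ι] [DecidableEq ι]
    (α v : ι → K) (d : ℕ) : Submodule K (ι → K) :=
  LinearMap.ker (grsParityCheck α v d).mulVecLin

/-- The `F`-subfield subcode `C ∩ F^n` of a `K`-linear code `C`. -/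
def subfieldSubcode (F : Type*) {ι K : Type*} [Field F] [Field K] [Algebra F K]
    (C : Submodule K (ι → K)) : Submodule F (ι → F) :=
  (C.restrictScalars F).comap ((Algebra.linearMap F K).compLeft ι)

/-- The alternant code: the `F`-subfield subcode of a GRS code. -/
def alternantCode (F : Type*) {ι K : Type*} [Field F] [Field K] [Algebra F K]
    [Fintype ι] [DecidableEq ι] (α v : ι → K) (d : ℕ) : Submodule F (ι → F) :=
  subfieldSubcode F (grsCode α v d)

/-- The `s`-interleaved code: the `s × n` matrices all of whose rows are in `C`. -/
def interleavedCode {ι F : Type*} [Field F] (s : ℕ) (C : Submodule F (ι → F)) :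
    Set (Matrix (Fin s) ι F) :=
  {M | ∀ i, M i ∈ C}

/-! ### Minimum distance, MDS codes -/

/-- The code `C` has minimum Hamming distance `δ`. (A code with at most one codeword has no
minimum distance.) -/
def HasMinDist {ι F : Type*} [Field F] [DecidableEq F] [Fintype ι]
    (C : Submodule F (ι → F)) (δ : ℕ) : Prop :=
  IsLeast {k : ℕ | ∃ x ∈ C, ∃ y ∈ C, x ≠ y ∧ hammingDist x y = k} δ

/-- The linear code `C` has minimum distance `δ` and meets the Singleton bound,
`dim C = n - δ + 1`. -/
def IsMDS {ι F : Type*} [Field F] [DecidableEq F] [Fintype ι]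
    (C : Submodule F (ι → F)) (δ : ℕ) : Prop :=
  HasMinDist C δ ∧ Module.finrank F C + δ = Fintype.card ι + 1

/-! ### Sums of cardinalities of subfield subcodes over all column multipliers -/

/-- `∑_{v ∈ (K^*)^n} |{c · diag(v) | c ∈ C, wt(c) = w} ∩ F^n|`. -/
def subcodeWeightSum (F : Type*) {ι K : Type*} [Field F] [Field K] [Algebra F K]
    [Fintype K] [DecidableEq K] [Fintype ι] [DecidableEq ι]
    (C : Submodule K (ι → K)) (w : ℕ) : ℕ :=
  ∑ v : ι → Kˣ,
    ({x : ι → K | ∃ c ∈ C, hammingNorm c = w ∧ x = fun i => c i * (v i : K)} ∩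
      Set.range (fun (a : ι → F) (i : ι) => algebraMap F K (a i))).ncard

/-- `∑_{v ∈ (K^*)^n} |{c · diag(v) | c ∈ C} ∩ F^n|`. -/
def subcodeCardSum (F : Type*) {ι K : Type*} [Field F] [Field K] [Algebra F K]
    [Fintype K] [DecidableEq K] [Fintype ι] [DecidableEq ι]
    (C : Submodule K (ι → K)) : ℕ :=
  ∑ v : ι → Kˣ,
    ({x : ι → K | ∃ c ∈ C, x = fun i => c i * (v i : K)} ∩
      Set.range (fun (a : ι → F) (i : ι) => algebraMap F K (a i))).ncard

/-- Number of codewords of weight `w` (`d ≤ w ≤ n`) in an MDS code of length `n` and minimum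
distance `d` over a field with `q ^ m` elements. -/
def mdsWeight (q m n d w : ℕ) : ℝ :=
  (n.choose w : ℝ) * ∑ j ∈ Finset.range (w - d + 1),
    (-1 : ℝ) ^ j * (w.choose j : ℝ) * ((q : ℝ) ^ (m * (w - d + 1 - j)) - 1)

/-- `B^MDS_{n,d,w}` for `d ≤ w ≤ n`. -/
def mdsB (q m n d w : ℕ) : ℝ :=
  mdsWeight q m n d w * ((q : ℝ) ^ m - 1) ^ (n - w) * ((q : ℝ) - 1) ^ w

/-- `B^MDS_{n,d}`. -/
def mdsBTotal (q m n d : ℕ) : ℝ :=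
  ((q : ℝ) ^ m - 1) ^ n + ∑ w ∈ Finset.Icc d n, mdsB q m n d w

/-! ### The syndrome-based joint decoder -/

/-- The syndromes `R · (H · diag(v))ᵀ`, one row for each row of `R`. -/
def syndromes {s : ℕ} {ι K : Type*} [Field K] [Fintype ι] [DecidableEq ι]
    (α v : ι → K) (d : ℕ) (R : Matrix (Fin s) ι K) : Matrix (Fin s) (Fin (d - 1)) K :=
  R * (grsParityCheck α v d).transpose

/-- The stacked matrix `S(t)`: the block of row `i` has the entries `s_{i, r+k-1}`
(`1 ≤ r ≤ d-1-t`, `1 ≤ k ≤ t`, counted from one). -/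
def keyMatrix {s : ℕ} {K : Type*} [Field K] {d : ℕ} (S : Matrix (Fin s) (Fin (d - 1)) K) (t : ℕ) :
    Matrix (Fin s × Fin (d - 1 - t)) (Fin t) K :=
  Matrix.of fun p k => S p.1 ⟨(p.2 : ℕ) + (k : ℕ), by omega⟩

/-- The stacked right-hand side `T(t)`, with the entries `-s_{i, t+r}` (`1 ≤ r ≤ d-1-t`). -/
def keyVector {s : ℕ} {K : Type*} [Field K] {d : ℕ} (S : Matrix (Fin s) (Fin (d - 1)) K) (t : ℕ) :
    Fin s × Fin (d - 1 - t) → K :=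
  fun p => -S p.1 ⟨t + (p.2 : ℕ), by omega⟩

/-- The vector `x` solves the key equation `S(t) · x = T(t)`. -/
def SolvesKey {s : ℕ} {K : Type*} [Field K] {d : ℕ} (S : Matrix (Fin s) (Fin (d - 1)) K) (t : ℕ)
    (x : Fin t → K) : Prop :=
  (keyMatrix S t).mulVec x = keyVector S t

/-- The smallest `t` for which the key equation has a solution. -/
def keyDegree {s : ℕ} {K : Type*} [Field K] {d : ℕ}
    (S : Matrix (Fin s) (Fin (d - 1)) K) : ℕ :=
  sInf {t : ℕ | ∃ x : Fin t → K, SolvesKey S t x}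

/-- For `t = d - 1` the key equation has no equations, so the minimum above is over a nonempty
set. -/
theorem solvesKey_nonempty {s : ℕ} {K : Type*} [Field K] {d : ℕ}
    (S : Matrix (Fin s) (Fin (d - 1)) K) :
    {t : ℕ | ∃ x : Fin t → K, SolvesKey S t x}.Nonempty := by
  refine ⟨d - 1, 0, ?_⟩
  funext p
  have h := p.2.isLt
  omega

/-- The polynomial `1 + Λ_1 X + ⋯ + Λ_t X ^ t`, where `x = (Λ_t, …, Λ_1)`. -/
def locatorPoly {K : Type*} [Field K] {t : ℕ} (x : Fin t → K) : K[X] :=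
  1 + ∑ k : Fin t, C (x k) * X ^ (t - (k : ℕ))

/-- Error evaluator for one row: `S(X) Λ(X) mod X ^ (d-1)` with `S(X) = ∑ s_ℓ X ^ (ℓ-1)`. -/
def errorEvaluator {K : Type*} [Field K] {d : ℕ} (S : Fin (d - 1) → K) (L : K[X]) : K[X] :=
  ((∑ l : Fin (d - 1), C (S l) * X ^ (l : ℕ)) * L) %ₘ (X ^ (d - 1))

open Classical in
/-- Forney's algorithm. The error positions are the `j` with `Λ(α_j⁻¹) = 0`, and the error value
in row `i` at such a `j` is `-(α_j / v_j) Ω_i(α_j⁻¹) / Λ'(α_j⁻¹)`. -/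
def forney {s : ℕ} {ι K : Type*} [Field K] (α v : ι → K) {d : ℕ}
    (S : Matrix (Fin s) (Fin (d - 1)) K) (L : K[X]) : Matrix (Fin s) ι K :=
  Matrix.of fun i j =>
    if L.eval (α j)⁻¹ = 0 then
      -(α j / v j) * (errorEvaluator (S i) L).eval (α j)⁻¹ / (derivative L).eval (α j)⁻¹
    else 0

open Classical in
/-- The syndrome-based joint decoder; `none` is a decoding failure. -/
def jointDecode {s : ℕ} {ι K : Type*} [Field K] [Fintype ι] [DecidableEq ι]
    (α v : ι → K) (d : ℕ) (R : Matrix (Fin s) ι K) : Option (Matrix (Fin s) ι K) :=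
  if syndromes α v d R = 0 then some R
  else
    if h : ∃! x : Fin (keyDegree (syndromes α v d R)) → K,
        SolvesKey (syndromes α v d R) (keyDegree (syndromes α v d R)) x then
      if {z : K | (locatorPoly h.choose).IsRoot z}.ncard = keyDegree (syndromes α v d R) then
        some (R - forney α v (syndromes α v d R) (locatorPoly h.choose))
      else none
    else none

/-! ### The burst error channel -/

/-- The matrices over `F` without zero columns. -/
def noZeroCols (s : ℕ) (κ F : Type*) [Field F] : Set (Matrix (Fin s) κ F) :=
  {E | ∀ j, ∃ i, E i j ≠ 0}

/-- The `s × n` error matrix with the columns of `E` at the positions `P`, and zero columns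
elsewhere. -/
def burst {s : ℕ} {ι F : Type*} [Field F] [DecidableEq ι] (P : Finset ι)
    (E : Matrix (Fin s) P F) : Matrix (Fin s) ι F :=
  Matrix.of fun i j => if h : j ∈ P then E i ⟨j, h⟩ else 0

/-- Decoding of the received word `M + burst P E`, a matrix over `F` that the decoder reads as a
matrix over `K`, returns the sent codeword `M`. -/
def DecodingSucceeds {s : ℕ} {ι F K : Type*} [Field F] [Field K] [Algebra F K] [Fintype ι]
    [DecidableEq ι] (α v : ι → K) (d : ℕ) (M : Matrix (Fin s) ι F) (P : Finset ι)
    (E : Matrix (Fin s) P F) : Prop :=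
  jointDecode α v d ((M + burst P E).map (algebraMap F K)) = some (M.map (algebraMap F K))

/-- The success probability, for the sent codeword `M` and an error with support `P` whose
restriction to `P` is uniformly distributed over the matrices without zero columns. -/
def successProb {s : ℕ} {ι F K : Type*} [Field F] [Field K] [Algebra F K] [Fintype ι]
    [DecidableEq ι] (α v : ι → K) (d : ℕ) (M : Matrix (Fin s) ι F) (P : Finset ι) : ℝ :=
  ({E : Matrix (Fin s) P F | E ∈ noZeroCols s P F ∧ DecodingSucceeds α v d M P E}.ncard : ℝ) /
    ((noZeroCols s P F).ncard : ℝ)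

end IntAlt

end

/-!
The syndromes of the received word are those of the error. On the `t` error positions the stacked
key matrix of degree `t` factors into a parity-check matrix of a GRS code with `d - t - 1` rows,
the error values, and an invertible Vandermonde matrix. If it is injective, then the error locator
polynomial is the only solution of degree `t`. A solution of degree `τ < t` would give a kernel
vector, so `t` is the least degree, and Forney's formula returns the error (`jointDecode_add_eq`).

Hence decoding fails only if some nonzero vector `c` on the error positions multiplies all rows of
the error into a GRS code of minimum distance `d - t`, and then so do all `q ^ m - 1` nonzero
multiples of `c`. The bad pairs are counted by the support `W` of `c` and by the restriction of `c`
to `W`, a vector of units `u` (`mul_card_bad_le_sum`). For given `W` and `u` the columns of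
the error in `W` form a matrix without zero columns with rows in the subfield subcode of
`D · diag(u)⁻¹`, where `D` is a GRS code of length `w = |W|`, and the other columns are free.

Summed over `u`, these matrices are bounded by `sum_card_noZeroCols_le`. From the `|A| ^ s`
matrices with rows in a code `A` one subtracts the zero matrix, and the matrices whose rows are
proportional to one nonzero word with a zero coordinate (`card_noZeroCols_add_le`). As `|A|` lies
between `a_w` (rank-nullity) and `b_w` (the bound on the dimension), the convex function
`x ↦ x ^ s` may be replaced by its secant, which leaves the sums over `u` of `|A|` and of the number
of words of full weight in `A`.

These sums depend only on the parameters of the MDS code `D`: a word of weight `i` of `D` is a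
multiple of a word over `F` by a vector of units in `(q - 1) ^ i (q ^ m - 1) ^ (w - i)` ways
(`sum_card_filter_mul_mem`), and the weight distribution of MDS codes follows by
inclusion-exclusion, since every set of at most `dim D` coordinates imposes independent conditions
(`finrank_vanishingOn`).
-/

noncomputable section

namespace IntAlt

/-! ### The weight distribution of MDS codes -/

section Weights

variable {ι K : Type*} [Field K]

/-- The words of `D` that vanish on `U`. -/
def vanishingOn (D : Submodule K (ι → K)) (U : Finset ι) : Submodule K (ι → K) :=
  D ⊓ LinearMap.ker (LinearMap.funLeft K K (Subtype.val : U → ι))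

lemma mem_vanishingOn {D : Submodule K (ι → K)} {U : Finset ι} {x : ι → K} :
    x ∈ vanishingOn D U ↔ x ∈ D ∧ ∀ j ∈ U, x j = 0 := by
  simp [vanishingOn, funext_iff, LinearMap.funLeft_apply]

lemma finrank_le_finrank_vanishingOn [Fintype ι] (D : Submodule K (ι → K)) (U : Finset ι) :
    Module.finrank K D ≤ Module.finrank K (vanishingOn D U) + U.card := by
  have h1 :=
    ((LinearMap.funLeft K K (Subtype.val : U → ι)).domRestrict D).finrank_range_add_finrank_ker
  have h2 : Module.finrank K
      (LinearMap.range ((LinearMap.funLeft K K (Subtype.val : U → ι)).domRestrict D)) ≤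
      U.card := by
    refine (Submodule.finrank_le _).trans ?_
    simp
  have h3 : Module.finrank K
      (LinearMap.ker ((LinearMap.funLeft K K (Subtype.val : U → ι)).domRestrict D)) =
      Module.finrank K (vanishingOn D U) := by
    rw [LinearMap.ker_domRestrict, vanishingOn,
      (Submodule.equivSubtypeMap D _).finrank_eq, Submodule.map_comap_subtype]
  omega

/-- A code of minimum weight at least `δ` has no nonzero word which vanishes at more than
`|ι| - δ` places. -/
lemma eq_zero_of_vanishing [Fintype ι] [DecidableEq K] {D : Submodule K (ι → K)} {δ : ℕ}
    (hδ : ∀ x ∈ D, x ≠ 0 → δ ≤ hammingNorm x) {x : ι → K} (hx : x ∈ D) {U : Finset ι}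
    (hU : Fintype.card ι < U.card + δ) (h : ∀ j ∈ U, x j = 0) : x = 0 := by
  classical
  by_contra hne
  have h1 := hδ x hx hne
  have h2 : hammingNorm x ≤ Uᶜ.card := by
    refine Finset.card_le_card fun j hj => ?_
    simp only [Finset.mem_compl]
    intro hjU
    exact (Finset.mem_filter.mp hj).2 (h j hjU)
  have h3 := Finset.card_compl_add_card U
  omega

/-- In an MDS code every set of at most `dim D` coordinates imposes independent conditions. -/
lemma finrank_vanishingOn [Fintype ι] [DecidableEq K] {D : Submodule K (ι → K)} {δ : ℕ}
    (h1 : 1 ≤ δ) (hδ : ∀ x ∈ D, x ≠ 0 → δ ≤ hammingNorm x)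
    (hD : Fintype.card ι + 1 ≤ Module.finrank K D + δ) (U : Finset ι) :
    Module.finrank K (vanishingOn D U) = Fintype.card ι + 1 - δ - U.card := by
  classical
  refine le_antisymm ?_ ?_
  · rcases le_total (Fintype.card ι + 1 - δ) U.card with h | h
    · have : vanishingOn D U = ⊥ := by
        rw [eq_bot_iff]
        intro x hx
        rw [mem_vanishingOn] at hx
        exact eq_zero_of_vanishing hδ hx.1 (by omega) hx.2
      rw [this, finrank_bot]
      exact Nat.zero_le _
    · obtain ⟨U', hU, hU'⟩ := Finset.exists_superset_card_eq h (by omega)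
      let g := (LinearMap.funLeft K K (Subtype.val : (U' \ U : Finset ι) → ι)).domRestrict
        (vanishingOn D U)
      have hg : Function.Injective g := by
        rw [← LinearMap.ker_eq_bot, eq_bot_iff]
        rintro ⟨x, hx⟩ hgx
        have hgx' : ∀ j ∈ U' \ U, x j = 0 := fun j hj => congrFun hgx ⟨j, hj⟩
        rw [mem_vanishingOn] at hx
        have := eq_zero_of_vanishing (U := U') hδ hx.1
          (by have := Finset.card_le_univ U'; omega) fun j hj => by
          by_cases hjU : j ∈ U
          · exact hx.2 j hjU
          · exact hgx' j (Finset.mem_sdiff.mpr ⟨hj, hjU⟩)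
        simpa using this
      have := LinearMap.finrank_le_finrank_of_injective hg
      rw [Module.finrank_fintype_fun_eq_card, Fintype.card_coe, Finset.card_sdiff_of_subset hU, hU']
        at this
      exact this
  · have := finrank_le_finrank_vanishingOn D U
    omega

variable [Fintype ι] [DecidableEq ι] [Fintype K] [DecidableEq K]

open Classical in
lemma card_filter_vanishing {D : Submodule K (ι → K)} {δ : ℕ} (h1 : 1 ≤ δ)
    (hδ : ∀ x ∈ D, x ≠ 0 → δ ≤ hammingNorm x)
    (hD : Fintype.card ι + 1 ≤ Module.finrank K D + δ) (U : Finset ι) :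
    (Finset.univ.filter fun x : ι → K => x ∈ D ∧ ∀ j ∈ U, x j = 0).card =
      Fintype.card K ^ (Fintype.card ι + 1 - δ - U.card) := by
  rw [← finrank_vanishingOn h1 hδ hD U, ← Module.card_eq_pow_finrank, Fintype.card_subtype]
  simp only [mem_vanishingOn]

open Classical in
/-- The number of words of an MDS code with a given support, by inclusion-exclusion over the
zero coordinates. -/
lemma card_filter_support {D : Submodule K (ι → K)} {δ : ℕ} (h1 : 1 ≤ δ)
    (hδ : ∀ x ∈ D, x ≠ 0 → δ ≤ hammingNorm x)
    (hD : Fintype.card ι + 1 ≤ Module.finrank K D + δ) (S : Finset ι) (hS : δ ≤ S.card) :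
    ((Finset.univ.filter fun x : ι → K => x ∈ D ∧
      (Finset.univ.filter fun j => x j ≠ 0) = S).card : ℝ) =
      ∑ j ∈ Finset.range (S.card - δ + 1), (-1 : ℝ) ^ j * (S.card.choose j : ℝ) *
        ((Fintype.card K : ℝ) ^ (S.card - δ + 1 - j) - 1) := by
  have hcard : S.card ≤ Fintype.card ι := Finset.card_le_univ S
  have hind : ∀ x : ι → K,
      (if x ∈ D ∧ (Finset.univ.filter fun j => x j ≠ 0) = S then (1 : ℝ) else 0)
      = ∑ U ∈ S.powerset, (-1 : ℝ) ^ U.card *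
        (if x ∈ D ∧ ∀ j ∈ U ∪ Sᶜ, x j = 0 then 1 else 0) := by
    intro x
    by_cases hx : x ∈ D ∧ ∀ j ∈ Sᶜ, x j = 0
    -- expand the product over `S` of the indicators `1 - [x j = 0]`
    · have h2 : ∏ j ∈ S, (-(if x j = 0 then (1 : ℝ) else 0) + 1) =
          if (Finset.univ.filter fun j => x j ≠ 0) = S then (1 : ℝ) else 0 := by
        split_ifs with h
        · refine Finset.prod_eq_one fun j hj => ?_
          rw [← h] at hj
          simp [(Finset.mem_filter.mp hj).2]
        · have : ∃ j ∈ S, x j = 0 := by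
            by_contra! hcon
            refine h (Finset.ext fun j => ?_)
            simp only [Finset.mem_filter, Finset.mem_univ, true_and]
            refine ⟨fun hj => ?_, hcon j⟩
            by_contra hjS
            exact hj (hx.2 j (Finset.mem_compl.mpr hjS))
          obtain ⟨j, hj, hj0⟩ := this
          exact Finset.prod_eq_zero hj (by simp [hj0])
      simp only [hx.1, true_and]
      rw [← h2, Finset.prod_add]
      refine Finset.sum_congr rfl fun U _ => ?_
      rw [Finset.prod_neg, Finset.prod_boole, Finset.prod_const_one, mul_one]
      congr 2
      simp only [Finset.mem_union, or_imp, forall_and, eq_iff_iff]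
      exact ⟨fun h => ⟨h, hx.2⟩, fun h => h.1⟩
    · rw [if_neg, eq_comm]
      · refine Finset.sum_eq_zero fun U _ => ?_
        rw [if_neg, mul_zero]
        exact fun h => hx ⟨h.1, fun j hj => h.2 j (Finset.mem_union_right _ hj)⟩
      · rintro ⟨h, rfl⟩
        exact hx ⟨h, fun j hj => by simpa using hj⟩
  have hsum : ((Finset.univ.filter fun x : ι → K => x ∈ D ∧
      (Finset.univ.filter fun j => x j ≠ 0) = S).card : ℝ) =
      ∑ U ∈ S.powerset, (-1 : ℝ) ^ U.card *
        ((Fintype.card K : ℝ) ^ (S.card + 1 - δ - U.card)) := by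
    rw [← Finset.sum_boole, Finset.sum_congr rfl fun x _ => hind x, Finset.sum_comm]
    refine Finset.sum_congr rfl fun U hU => ?_
    rw [← Finset.mul_sum, Finset.sum_boole, card_filter_vanishing h1 hδ hD, Nat.cast_pow]
    have hdisj : Disjoint U Sᶜ :=
      Finset.disjoint_left.mpr fun j hj hj' =>
        Finset.mem_compl.mp hj' (Finset.mem_powerset.mp hU hj)
    rw [Finset.card_union_of_disjoint hdisj, Finset.card_compl]
    congr 2
    omega
  have halt : ∑ U ∈ S.powerset, (-1 : ℝ) ^ U.card = 0 := by
    have h := Finset.sum_powerset_neg_one_pow_card_of_nonempty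
      (Finset.card_pos.mp (by omega : 0 < S.card))
    exact_mod_cast congrArg (Int.cast : ℤ → ℝ) h
  -- the alternating sum of ones vanishes, so each term may be lowered by one
  rw [hsum, ← sub_zero (∑ U ∈ S.powerset, _), ← halt, ← Finset.sum_sub_distrib]
  have hf := Finset.sum_powerset_apply_card (x := S) (fun j : ℕ => (-1 : ℝ) ^ j *
    ((Fintype.card K : ℝ) ^ (S.card + 1 - δ - j) - 1))
  simp only [← mul_sub_one]
  rw [hf]
  symm
  rw [Finset.sum_subset (Finset.range_mono (show S.card - δ + 1 ≤ S.card + 1 by omega))]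
  · refine Finset.sum_congr rfl fun j _ => ?_
    rw [show S.card - δ + 1 - j = S.card + 1 - δ - j by omega, nsmul_eq_mul]
    ring
  · intro j _ hj
    rw [Finset.mem_range] at hj
    rw [show S.card - δ + 1 - j = 0 by omega]
    simp

open Classical in
/-- The weight distribution of an MDS code. -/
lemma card_filter_hammingNorm {D : Submodule K (ι → K)} {δ q m i : ℕ}
    (hQ : Fintype.card K = q ^ m) (h1 : 1 ≤ δ)
    (hδ : ∀ x ∈ D, x ≠ 0 → δ ≤ hammingNorm x)
    (hD : Fintype.card ι + 1 ≤ Module.finrank K D + δ) (hi : δ ≤ i) :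
    ((Finset.univ.filter fun x : ι → K => x ∈ D ∧ hammingNorm x = i).card : ℝ) =
      mdsWeight q m (Fintype.card ι) δ i := by
  have hmaps : ∀ x ∈ Finset.univ.filter fun x : ι → K => x ∈ D ∧ hammingNorm x = i,
      (Finset.univ.filter fun j => x j ≠ 0) ∈ (Finset.univ : Finset ι).powersetCard i := by
    intro x hx
    rw [Finset.mem_powersetCard]
    exact ⟨Finset.subset_univ _, (Finset.mem_filter.mp hx).2.2⟩
  rw [Finset.card_eq_sum_card_fiberwise hmaps, Nat.cast_sum, mdsWeight,
    Finset.sum_congr rfl (g := fun _ => ∑ j ∈ Finset.range (i - δ + 1),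
      (-1 : ℝ) ^ j * (i.choose j : ℝ) * ((q : ℝ) ^ (m * (i - δ + 1 - j)) - 1))]
  · rw [Finset.sum_const, Finset.card_powersetCard, nsmul_eq_mul, Finset.card_univ]
  · intro S hS
    have hS' := (Finset.mem_powersetCard.mp hS).2
    have := card_filter_support h1 hδ hD S (by omega)
    rw [hS'] at this
    simp only [pow_mul, ← Nat.cast_pow, ← hQ]
    simp only [Nat.cast_pow]
    rw [← this, Finset.filter_filter]
    congr 2
    ext x
    simp only [Finset.mem_filter, Finset.mem_univ, true_and]
    constructor
    · rintro ⟨⟨h, -⟩, h'⟩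
      exact ⟨h, h'⟩
    · rintro ⟨h, rfl⟩
      exact ⟨⟨h, hS'⟩, rfl⟩

end Weights

/-! ### Subfield subcodes under column multipliers -/

section Multipliers

variable {F ι K : Type*} [Field F] [Field K] [Algebra F K]

/-- The words over `F` which become words of `D` when multiplied by `u`, that is, the subfield
subcode of `D · diag(u)⁻¹`. -/
def twistedSubcode (F : Type*) [Field F] [Algebra F K] (D : Submodule K (ι → K)) (u : ι → Kˣ) :
    Submodule F (ι → F) :=
  subfieldSubcode F (D.comap (LinearMap.pi fun i => (u i : K) • LinearMap.proj i))

lemma mem_twistedSubcode {D : Submodule K (ι → K)} {u : ι → Kˣ} {a : ι → F} :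
    a ∈ twistedSubcode F D u ↔ (fun i => algebraMap F K (a i) * (u i : K)) ∈ D := by
  simp only [twistedSubcode, subfieldSubcode, Submodule.mem_comap, Submodule.restrictScalars_mem]
  refine Iff.of_eq (congrArg (· ∈ D) (funext fun i => ?_))
  simp [mul_comm]

lemma hammingNorm_algebraMap_mul [Fintype ι] [DecidableEq F] [DecidableEq K] (a : ι → F)
    (u : ι → Kˣ) :
    hammingNorm (fun i => algebraMap F K (a i) * (u i : K)) = hammingNorm a := by
  simp [hammingNorm]

variable [Fintype ι] [DecidableEq ι] [Fintype F] [Fintype K] [DecidableEq K]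

open Classical in
/-- The number of factorizations of `z` into a unit of `K` and an element of `F`, which is zero if
and only if `z` is. -/
lemma card_factorizations (z : K) :
    (Finset.univ.filter fun p : Kˣ × F => algebraMap F K p.2 * (p.1 : K) = z).card =
      if z = 0 then Fintype.card K - 1 else Fintype.card F - 1 := by
  split_ifs with hz
  · rw [← Fintype.card_units, ← Finset.card_univ]
    symm
    refine Finset.card_bij (fun u _ => (u, 0)) ?_ ?_ ?_
    · simp [hz]
    · intro a _ b _ h
      exact congrArg Prod.fst h
    · rintro ⟨u, a⟩ h
      simp only [Finset.mem_filter, Finset.mem_univ, true_and, hz, mul_eq_zero, Units.ne_zero,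
        or_false, map_eq_zero] at h
      exact ⟨u, Finset.mem_univ _, by rw [h]⟩
  · rw [← Fintype.card_units, ← Finset.card_univ]
    symm
    refine Finset.card_bij
      (fun a _ => ((Units.map (algebraMap F K : F →* K) a)⁻¹ * Units.mk0 z hz, (a : F))) ?_ ?_ ?_
    · intro a _
      simp
    · intro a _ b _ h
      exact Units.ext (congrArg Prod.snd h)
    · rintro ⟨u, a⟩ h
      simp only [Finset.mem_filter, Finset.mem_univ, true_and] at h
      have ha : a ≠ 0 := by
        rintro rfl
        simp at h
        exact hz h.symm
      refine ⟨Units.mk0 a ha, Finset.mem_univ _, Prod.ext (Units.ext ?_) rfl⟩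
      have : algebraMap F K a ≠ 0 := by simpa using ha
      simp [← h, this]

open Classical in
/-- Counting pairs: each `c ∈ S` is of the form `a · diag(u)` in `q - 1` ways at each place of its
support, and in `q ^ m - 1` ways at each other place. -/
lemma sum_card_filter_mul_mem [DecidableEq F] (S : Finset (ι → K)) :
    ∑ u : ι → Kˣ, (Finset.univ.filter fun a : ι → F =>
      (fun i => algebraMap F K (a i) * (u i : K)) ∈ S).card =
    ∑ c ∈ S, (Fintype.card K - 1) ^ (Fintype.card ι - hammingNorm c) *
      (Fintype.card F - 1) ^ hammingNorm c := by
  have h1 : ∀ c : ι → K, (Finset.univ.filter fun p : ι → Kˣ × F =>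
      (fun i => algebraMap F K (p i).2 * ((p i).1 : K)) = c).card =
      (Fintype.card K - 1) ^ (Fintype.card ι - hammingNorm c) *
      (Fintype.card F - 1) ^ hammingNorm c := by
    intro c
    have : (Finset.univ.filter fun p : ι → Kˣ × F =>
      (fun i => algebraMap F K (p i).2 * ((p i).1 : K)) = c) =
      Fintype.piFinset fun i =>
        Finset.univ.filter fun p : Kˣ × F => algebraMap F K p.2 * (p.1 : K) = c i := by
      ext p
      simp [Fintype.mem_piFinset, funext_iff]
    rw [this, Fintype.card_piFinset, Finset.prod_congr rfl fun i _ => card_factorizations (c i),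
      Finset.prod_ite, Finset.prod_const, Finset.prod_const]
    congr 2
    have := Finset.card_filter_add_card_filter_not (s := (Finset.univ : Finset ι))
      (fun i => c i = 0)
    rw [Finset.card_univ] at this
    simp only [hammingNorm, ne_eq]
    omega
  simp only [← h1]
  have h2 : ∀ u : ι → Kˣ, (Finset.univ.filter fun a : ι → F =>
      (fun i => algebraMap F K (a i) * (u i : K)) ∈ S).card =
      ∑ a : ι → F, ∑ c ∈ S, if (fun i => algebraMap F K (a i) * (u i : K)) = c then 1 else 0 := by
    intro u
    rw [Finset.card_filter]
    exact Finset.sum_congr rfl fun a _ => by simp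
  simp only [h2]
  rw [← Fintype.sum_prod_type', Finset.sum_comm]
  refine Finset.sum_congr rfl fun c _ => ?_
  rw [Finset.card_filter]
  exact ((Equiv.arrowProdEquivProdArrow ι (fun _ => Kˣ) (fun _ => F)).sum_comp
    fun x : (ι → Kˣ) × (ι → F) =>
      if (fun i => algebraMap F K (x.2 i) * (x.1 i : K)) = c then 1 else 0).symm

open Classical in
/-- The words over `F` among the multiples `c · diag(v)`, `c ∈ S`, counted by their coordinates
in `F`. -/
lemma sum_ncard_multiples (S : Set (ι → K)) :
    ∑ v : ι → Kˣ, ({x : ι → K | ∃ c ∈ S, x = fun i => c i * (v i : K)} ∩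
      Set.range (fun (a : ι → F) (i : ι) => algebraMap F K (a i))).ncard =
    ∑ u : ι → Kˣ, (Finset.univ.filter fun a : ι → F =>
      (fun i => algebraMap F K (a i) * (u i : K)) ∈ S).card := by
  rw [← Equiv.sum_comp (Equiv.inv (ι → Kˣ))]
  refine Finset.sum_congr rfl fun v _ => ?_
  have hinj : Function.Injective fun (a : ι → F) (i : ι) => algebraMap F K (a i) :=
    fun a b h => funext fun i => (algebraMap F K).injective (congrFun h i)
  rw [← Set.ncard_coe_finset, ← Set.ncard_image_of_injective _ hinj]
  congr 1
  ext x
  simp only [Set.mem_inter_iff, Set.mem_ofPred_eq, Set.mem_range, Finset.coe_filter,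
    Finset.mem_univ, true_and, Set.mem_image]
  constructor
  · rintro ⟨⟨c, hc, rfl⟩, a, ha⟩
    refine ⟨a, ?_, ha⟩
    convert! hc using 1
    funext i
    rw [congrFun ha i]
    simp
  · rintro ⟨a, ha, rfl⟩
    refine ⟨⟨_, ha, ?_⟩, a, rfl⟩
    funext i
    simp

open Classical in
lemma subcodeCardSum_eq (D : Submodule K (ι → K)) :
    subcodeCardSum F D =
      ∑ u : ι → Kˣ, (Finset.univ.filter fun a : ι → F => a ∈ twistedSubcode F D u).card := by
  simp only [mem_twistedSubcode]
  exact sum_ncard_multiples (D : Set (ι → K))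

open Classical in
lemma subcodeWeightSum_eq [DecidableEq F] (D : Submodule K (ι → K)) (i : ℕ) :
    subcodeWeightSum F D i =
      ∑ u : ι → Kˣ, (Finset.univ.filter fun a : ι → F =>
        a ∈ twistedSubcode F D u ∧ hammingNorm a = i).card := by
  have h := sum_ncard_multiples (F := F) {c : ι → K | c ∈ D ∧ hammingNorm c = i}
  simp only [Set.mem_ofPred_eq, hammingNorm_algebraMap_mul, and_assoc] at h
  simp only [mem_twistedSubcode]
  exact h

open Classical in
/-- For an MDS code the sum over all column multipliers of the number of words of weight `i` in
the subfield subcode depends only on the parameters of the code. -/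
lemma sum_card_twistedSubcode_weight [DecidableEq F] {D : Submodule K (ι → K)} {δ q m i : ℕ}
    (hq : Fintype.card F = q) (hQ : Fintype.card K = q ^ m) (h1 : 1 ≤ δ)
    (hδ : ∀ x ∈ D, x ≠ 0 → δ ≤ hammingNorm x)
    (hD : Fintype.card ι + 1 ≤ Module.finrank K D + δ) (hi : δ ≤ i) :
    ((∑ u : ι → Kˣ, (Finset.univ.filter fun a : ι → F =>
        a ∈ twistedSubcode F D u ∧ hammingNorm a = i).card : ℕ) : ℝ) =
      mdsB q m (Fintype.card ι) δ i := by
  have h := sum_card_filter_mul_mem (F := F)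
    (Finset.univ.filter fun x : ι → K => x ∈ D ∧ hammingNorm x = i)
  simp only [Finset.mem_filter, Finset.mem_univ, true_and, hammingNorm_algebraMap_mul] at h
  simp only [mem_twistedSubcode]
  rw [h, Finset.sum_congr rfl (g := fun _ => (Fintype.card K - 1) ^ (Fintype.card ι - i) *
    (Fintype.card F - 1) ^ i) fun c hc => by rw [(Finset.mem_filter.mp hc).2.2],
    Finset.sum_const, smul_eq_mul, mdsB, ← card_filter_hammingNorm hQ h1 hδ hD hi]
  push_cast [Nat.cast_sub (Fintype.card_pos (α := K)), Nat.cast_sub (Fintype.card_pos (α := F))]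
  rw [hQ, hq]
  push_cast
  ring

open Classical in
lemma sum_card_twistedSubcode [DecidableEq F] {D : Submodule K (ι → K)} {δ q m : ℕ}
    (hq : Fintype.card F = q) (hQ : Fintype.card K = q ^ m) (h1 : 1 ≤ δ)
    (hδ : ∀ x ∈ D, x ≠ 0 → δ ≤ hammingNorm x)
    (hD : Fintype.card ι + 1 ≤ Module.finrank K D + δ) :
    ((∑ u : ι → Kˣ, (Finset.univ.filter fun a : ι → F =>
        a ∈ twistedSubcode F D u).card : ℕ) : ℝ) =
      mdsBTotal q m (Fintype.card ι) δ := by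
  have hmaps : ∀ u : ι → Kˣ, ∀ a ∈ Finset.univ.filter (fun a : ι → F => a ∈ twistedSubcode F D u),
      hammingNorm a ∈ insert 0 (Finset.Icc δ (Fintype.card ι)) := by
    intro u a ha
    rw [Finset.mem_filter, mem_twistedSubcode] at ha
    rw [Finset.mem_insert, Finset.mem_Icc, ← hammingNorm_algebraMap_mul (K := K) a u]
    rcases eq_or_ne (hammingNorm (fun i => algebraMap F K (a i) * (u i : K))) 0 with h | h
    · exact Or.inl h
    · exact Or.inr ⟨hδ _ ha.2 (hammingNorm_ne_zero_iff.mp h), hammingNorm_le_card_fintype⟩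
  rw [Finset.sum_congr rfl fun u _ => Finset.card_eq_sum_card_fiberwise (hmaps u), Finset.sum_comm,
    Finset.sum_insert (by simp; omega), Nat.cast_add, Nat.cast_sum, mdsBTotal]
  simp only [Finset.filter_filter]
  congr 1
  · have : ∀ u : ι → Kˣ, (Finset.univ.filter fun a : ι → F =>
        a ∈ twistedSubcode F D u ∧ hammingNorm a = 0) = {0} := by
      intro u
      ext a
      simp only [Finset.mem_filter, Finset.mem_univ, true_and, hammingNorm_eq_zero,
        Finset.mem_singleton]
      exact ⟨fun h => h.2, fun h => ⟨h ▸ Submodule.zero_mem _, h⟩⟩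
    simp only [this, Finset.card_singleton, Finset.sum_const, Finset.card_univ,
      Fintype.card_fun, Fintype.card_units, hQ, Nat.cast_one, nsmul_eq_mul, mul_one]
    push_cast [Nat.cast_sub (show 1 ≤ q ^ m from hQ ▸ Fintype.card_pos)]
    rfl
  · rw [Nat.cast_sum]
    refine Finset.sum_congr rfl fun i hi => ?_
    exact sum_card_twistedSubcode_weight hq hQ h1 hδ hD (Finset.mem_Icc.mp hi).1

end Multipliers

/-! ### Matrices without zero columns in an interleaved code -/

section NoZeroCols

variable {F κ : Type*} [Field F] [Fintype F] [DecidableEq F] [Fintype κ] [DecidableEq κ]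

open Classical in
/-- Matrices whose nonzero rows are all proportional to one nonzero word with a zero coordinate
have a zero column. For each such word there are `q ^ s - 1` of them, and `q - 1` words give the
same matrices. The zero matrix is one more matrix with a zero column. -/
lemma card_noZeroCols_add_le [Nonempty κ] (A : Submodule F (κ → F)) (s : ℕ) :
    ((Finset.univ.filter fun E : Fin s → κ → F =>
        (∀ i, E i ∈ A) ∧ ∀ j, ∃ i, E i j ≠ 0).card : ℝ) + 1 +
      ((Fintype.card F : ℝ) ^ s - 1) / ((Fintype.card F : ℝ) - 1) *
        (Finset.univ.filter fun a : κ → F => a ∈ A ∧ a ≠ 0 ∧ ∃ j, a j = 0).card ≤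
      ((Finset.univ.filter fun a : κ → F => a ∈ A).card : ℝ) ^ s := by
  set N := Finset.univ.filter fun E : Fin s → κ → F => (∀ i, E i ∈ A) ∧ ∀ j, ∃ i, E i j ≠ 0
  set Z := Finset.univ.filter fun a : κ → F => a ∈ A ∧ a ≠ 0 ∧ ∃ j, a j = 0
  let f : (κ → F) × (Fin s → F) → Fin s → κ → F := fun p i j => p.2 i * p.1 j
  set L : Finset (Fin s → F) := Finset.univ.erase 0
  have hL : L.card = Fintype.card F ^ s - 1 := by
    rw [Finset.card_erase_of_mem (Finset.mem_univ _), Finset.card_univ]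
    simp
  set I := (Z ×ˢ L).image f
  -- two pairs with the same product differ by a scalar `μ`, which is read off at a place where
  -- the product is nonzero
  have hfib : (Z ×ˢ L).card ≤ (Fintype.card F - 1) * I.card := by
    refine Finset.card_le_mul_card_image _ _ fun E hE => ?_
    obtain ⟨⟨a, l⟩, hal, rfl⟩ := Finset.mem_image.mp hE
    rw [Finset.mem_product, Finset.mem_filter, Finset.mem_erase] at hal
    obtain ⟨⟨-, -, ha, -⟩, hl, -⟩ := hal
    obtain ⟨j₀, hj₀⟩ := Function.ne_iff.mp ha
    obtain ⟨i₀, hi₀⟩ := Function.ne_iff.mp hl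
    rw [← Fintype.card_units, ← Finset.card_univ]
    refine (Finset.card_le_card (t := Finset.univ.image
      fun μ : Fˣ => ((fun j => (μ : F) * a j), fun i => (μ⁻¹ : F) * l i)) ?_).trans
      Finset.card_image_le
    rintro ⟨a', l'⟩ h
    rw [Finset.mem_filter] at h
    have hf : ∀ i j, l' i * a' j = l i * a j := fun i j => congrFun (congrFun h.2 i) j
    simp only [Pi.zero_apply] at hi₀ hj₀
    have hne : l' i₀ * a' j₀ ≠ 0 := hf i₀ j₀ ▸ mul_ne_zero hi₀ hj₀
    have hl' : l' i₀ ≠ 0 := left_ne_zero_of_mul hne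
    have ha' : a' j₀ ≠ 0 := right_ne_zero_of_mul hne
    rw [Finset.mem_image]
    refine ⟨Units.mk0 (l i₀ / l' i₀) (div_ne_zero hi₀ hl'), Finset.mem_univ _, ?_⟩
    refine Prod.ext (funext fun j => ?_) (funext fun i => ?_)
    · have := hf i₀ j
      simp only [Units.val_mk0]
      field_simp
      linear_combination -this
    · have h1 := hf i j₀
      have h2 := hf i₀ j₀
      simp only [Units.val_mk0]
      field_simp
      refine mul_right_cancel₀ ha' (mul_right_cancel₀ hj₀ ?_)
      linear_combination (l i * a j₀) * h2 - (l i₀ * a j₀) * h1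
  have hsub : N ∪ insert 0 I ⊆ Fintype.piFinset fun _ : Fin s =>
      Finset.univ.filter fun a : κ → F => a ∈ A := by
    intro E hE
    rw [Fintype.mem_piFinset]
    intro i
    rw [Finset.mem_filter]
    refine ⟨Finset.mem_univ _, ?_⟩
    rw [Finset.mem_union, Finset.mem_insert] at hE
    rcases hE with hE | rfl | hE
    · exact (Finset.mem_filter.mp hE).2.1 i
    · exact A.zero_mem
    · obtain ⟨⟨a, l⟩, hal, rfl⟩ := Finset.mem_image.mp hE
      rw [Finset.mem_product, Finset.mem_filter] at hal
      exact A.smul_mem (l i) hal.1.2.1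
  have hdisj : Disjoint N (insert 0 I) := by
    rw [Finset.disjoint_left]
    intro E hE hE'
    have hE := (Finset.mem_filter.mp hE).2.2
    rw [Finset.mem_insert] at hE'
    rcases hE' with rfl | hE'
    · obtain ⟨i, hi⟩ := hE (Classical.arbitrary κ)
      exact hi rfl
    · obtain ⟨⟨a, l⟩, hal, rfl⟩ := Finset.mem_image.mp hE'
      rw [Finset.mem_product, Finset.mem_filter] at hal
      obtain ⟨j, hj⟩ := hal.1.2.2.2
      obtain ⟨i, hi⟩ := hE j
      exact hi (mul_eq_zero_of_right _ hj)
  have h0 : (0 : Fin s → κ → F) ∉ I := by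
    intro h
    obtain ⟨⟨a, l⟩, hal, h⟩ := Finset.mem_image.mp h
    rw [Finset.mem_product, Finset.mem_filter, Finset.mem_erase] at hal
    obtain ⟨⟨-, -, ha, -⟩, hl, -⟩ := hal
    obtain ⟨j₀, hj₀⟩ := Function.ne_iff.mp ha
    obtain ⟨i₀, hi₀⟩ := Function.ne_iff.mp hl
    exact mul_ne_zero hi₀ hj₀ (congrFun (congrFun h i₀) j₀)
  have hcard := Finset.card_le_card hsub
  rw [Finset.card_union_of_disjoint hdisj, Finset.card_insert_of_notMem h0,
    Fintype.card_piFinset_const] at hcard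
  rw [Finset.card_product, hL] at hfib
  have hq : (1 : ℝ) < Fintype.card F := by exact_mod_cast Fintype.one_lt_card
  have h1 : 1 ≤ Fintype.card F ^ s := Nat.one_le_pow _ _ Fintype.card_pos
  have hfib' : (Z.card : ℝ) * ((Fintype.card F : ℝ) ^ s - 1) ≤
      ((Fintype.card F : ℝ) - 1) * I.card := by
    have := (Nat.cast_le (α := ℝ)).mpr hfib
    push_cast [Nat.cast_sub h1, Nat.cast_sub (Fintype.card_pos (α := F))] at this
    simpa using this
  have hI : ((Fintype.card F : ℝ) ^ s - 1) / ((Fintype.card F : ℝ) - 1) * Z.card ≤ I.card := by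
    rw [div_mul_eq_mul_div, div_le_iff₀ (by linarith)]
    linarith
  have hcard' : (N.card : ℝ) + (I.card + 1) ≤
      ((Finset.univ.filter fun a : κ → F => a ∈ A).card : ℝ) ^ s := by
    exact_mod_cast hcard
  linarith

open Classical in
/-- The words of a code are the zero word, the nonzero words with a zero coordinate, and the words
of full weight. -/
lemma card_eq_add_card_full_weight [Nonempty κ] (A : Submodule F (κ → F)) :
    (Finset.univ.filter fun a : κ → F => a ∈ A).card =
      1 + (Finset.univ.filter fun a : κ → F => a ∈ A ∧ a ≠ 0 ∧ ∃ j, a j = 0).card +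
      (Finset.univ.filter fun a : κ → F => a ∈ A ∧ hammingNorm a = Fintype.card κ).card := by
  have hfull : ∀ a : κ → F, hammingNorm a = Fintype.card κ ↔ ∀ j, a j ≠ 0 := by
    intro a
    rw [hammingNorm, ← Finset.card_univ, Finset.card_filter_eq_iff]
    simp
  simp only [hfull]
  rw [← Finset.card_filter_add_card_filter_not (fun a : κ → F => ∀ j, a j ≠ 0),
    Finset.filter_filter, Finset.filter_filter, add_comm]
  congr 1
  rw [add_comm, ← Finset.card_insert_of_notMem (a := (0 : κ → F)) (by simp)]
  congr 1
  ext a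
  simp only [Finset.mem_filter, Finset.mem_univ, true_and, Finset.mem_insert]
  push Not
  constructor
  · rintro ⟨ha, h⟩
    by_cases h0 : a = 0
    · exact Or.inl h0
    · exact Or.inr ⟨ha, h0, h⟩
  · rintro (rfl | ⟨ha, -, h⟩)
    · exact ⟨A.zero_mem, Classical.arbitrary κ, rfl⟩
    · exact ⟨ha, h⟩

end NoZeroCols

/-- The graph of `x ↦ x ^ s` lies below its secants; the secant through a single point is read as
a constant. -/
lemma pow_le_secant {a x b : ℝ} (ha : 0 ≤ a) (hax : a ≤ x) (hxb : x ≤ b) (s : ℕ) :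
    x ^ s ≤ a ^ s + (x - a) / (b - a) * (b ^ s - a ^ s) := by
  rcases eq_or_lt_of_le (hax.trans hxb) with h | h
  · subst h
    have : x = a := le_antisymm hxb hax
    simp [this]
  · have hba : 0 < b - a := sub_pos.mpr h
    have hc := (convexOn_pow (𝕜 := ℝ) s).2 (Set.mem_Ici.mpr ha) (Set.mem_Ici.mpr (ha.trans h.le))
      (div_nonneg (sub_nonneg.mpr hxb) hba.le) (div_nonneg (sub_nonneg.mpr hax) hba.le)
      (by field_simp; ring)
    have hx : (b - x) / (b - a) * a + (x - a) / (b - a) * b = x := by field_simp; ring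
    have h1 : (b - x) / (b - a) = 1 - (x - a) / (b - a) := by field_simp; ring
    simp only [smul_eq_mul, hx] at hc
    rw [h1] at hc
    linarith

/-! ### Bounds on the dimension of the subfield subcodes -/

section Dimension

lemma hasMinDist_iff {ι F : Type*} [Field F] [DecidableEq F] [Fintype ι]
    {A : Submodule F (ι → F)} {δ : ℕ} :
    HasMinDist A δ ↔
      (∃ x ∈ A, x ≠ 0 ∧ hammingNorm x = δ) ∧ ∀ x ∈ A, x ≠ 0 → δ ≤ hammingNorm x := by
  constructor
  · rintro ⟨⟨x, hx, y, hy, hne, h⟩, hle⟩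
    refine ⟨⟨-x + y, A.add_mem (A.neg_mem hx) hy, fun h0 => hne (neg_add_eq_zero.mp h0), ?_⟩,
      fun x hx h0 => ?_⟩
    · rw [← hammingDist_eq_hammingNorm, h]
    · exact hle ⟨x, hx, 0, A.zero_mem, h0, hammingDist_zero_right x⟩
  · rintro ⟨⟨x, hx, h0, h⟩, hle⟩
    refine ⟨⟨x, hx, 0, A.zero_mem, h0, by rw [hammingDist_zero_right, h]⟩, ?_⟩
    rintro k ⟨x, hx, y, hy, hne, rfl⟩
    rw [hammingDist_eq_hammingNorm]
    exact hle _ (A.add_mem (A.neg_mem hx) hy) fun h0 => hne (neg_add_eq_zero.mp h0)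

/-- Setting a coordinate to zero lowers the minimum distance of a code by at most one. Hence every
minimum distance between one and that of the code is attained by a code of the same dimension. -/
lemma exists_hasMinDist_of_word {ι F : Type*} [Field F] [DecidableEq F] [Fintype ι] {δ : ℕ}
    (h1 : 1 ≤ δ) (k : ℕ) (A : Submodule F (ι → F)) (hA : ∀ x ∈ A, x ≠ 0 → δ ≤ hammingNorm x)
    (hk : ∃ x ∈ A, x ≠ 0 ∧ hammingNorm x ≤ δ + k) :
    ∃ A' : Submodule F (ι → F), HasMinDist A' δ ∧ Module.finrank F A ≤ Module.finrank F A' := by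
  classical
  induction k generalizing A with
  | zero =>
    obtain ⟨x, hx, h0, h⟩ := hk
    exact ⟨A, hasMinDist_iff.mpr ⟨⟨x, hx, h0, le_antisymm h (hA x hx h0)⟩, hA⟩, le_rfl⟩
  | succ k ih =>
    by_cases hex : ∃ x ∈ A, x ≠ 0 ∧ hammingNorm x ≤ δ + k
    · exact ih A hA hex
    · push Not at hex
      obtain ⟨x, hx, h0, h⟩ := hk
      obtain ⟨j, hj⟩ := Function.ne_iff.mp h0
      simp only [Pi.zero_apply] at hj
      let π : (ι → F) →ₗ[F] (ι → F) :=
        LinearMap.pi fun i => if i = j then 0 else LinearMap.proj i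
      have hπ : ∀ y i, π y i = if i = j then 0 else y i := by
        intro y i
        simp only [π, LinearMap.pi_apply]
        split_ifs <;> simp
      have hsupp : ∀ y, (Finset.univ.filter fun i => π y i ≠ 0) =
          (Finset.univ.filter fun i => y i ≠ 0).erase j := by
        intro y
        ext i
        simp [hπ]
      have hwt : ∀ y, hammingNorm y ≤ hammingNorm (π y) + 1 := by
        intro y
        have := Finset.pred_card_le_card_erase (s := Finset.univ.filter fun i => y i ≠ 0) (a := j)
        rw [← hsupp] at this
        simp only [hammingNorm]
        omega
      have hlow : ∀ y ∈ A, y ≠ 0 → δ + k ≤ hammingNorm (π y) := by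
        intro y hy hy0
        have := hex y hy hy0
        have := hwt y
        omega
      have hwx : hammingNorm (π x) + 1 = hammingNorm x := by
        have := Finset.card_erase_add_one (s := Finset.univ.filter fun i => x i ≠ 0) (a := j)
          (by simpa using hj)
        rwa [← hsupp] at this
      have hnz : ∀ y ∈ A, y ≠ 0 → π y ≠ 0 := by
        intro y hy hy0 hz
        have := hlow y hy hy0
        rw [hz, hammingNorm_zero] at this
        omega
      have hinj : Function.Injective (π.domRestrict A) := by
        rw [← LinearMap.ker_eq_bot, eq_bot_iff]
        rintro ⟨y, hy⟩ hy'
        by_contra hne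
        exact hnz y hy (fun h => hne (by simp [h])) hy'
      obtain ⟨A', hA', hle⟩ := ih (A.map π) (by
          rintro _ ⟨y, hy, rfl⟩ hy0
          have := hlow y hy (by rintro rfl; exact hy0 (map_zero π))
          omega) ⟨π x, Submodule.mem_map_of_mem hx, hnz x hx h0, by omega⟩
      refine ⟨A', hA', le_trans (le_of_eq ?_) hle⟩
      rw [← LinearMap.range_domRestrict, LinearMap.finrank_range_of_inj hinj]

lemma exists_hasMinDist {ι F : Type*} [Field F] [DecidableEq F] [Fintype ι] {δ : ℕ}
    (h1 : 1 ≤ δ) (hι : δ ≤ Fintype.card ι) (A : Submodule F (ι → F))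
    (hA : ∀ x ∈ A, x ≠ 0 → δ ≤ hammingNorm x) :
    ∃ A' : Submodule F (ι → F), HasMinDist A' δ ∧ Module.finrank F A ≤ Module.finrank F A' := by
  classical
  -- the zero code has no minimum distance and is replaced by a code of dimension one
  by_cases hbot : A = ⊥
  · obtain ⟨S, -, hS⟩ := Finset.exists_subset_card_eq (s := (Finset.univ : Finset ι)) hι
    let x : ι → F := fun i => if i ∈ S then 1 else 0
    have hx : ∀ c : F, c ≠ 0 → hammingNorm (c • x) = δ := by
      intro c hc
      simp [hammingNorm, x, hc, hS]
    have hx0 : hammingNorm x = δ := by simpa using hx 1 one_ne_zero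
    refine ⟨F ∙ x, hasMinDist_iff.mpr ⟨⟨x, Submodule.mem_span_singleton_self x, ?_, hx0⟩, ?_⟩, ?_⟩
    · rintro h
      rw [h, hammingNorm_zero] at hx0
      omega
    · intro y hy hy0
      obtain ⟨c, rfl⟩ := Submodule.mem_span_singleton.mp hy
      exact (hx c (by rintro rfl; simp at hy0)).ge
    · rw [hbot, finrank_bot]
      exact Nat.zero_le _
  · obtain ⟨x, hx, h0⟩ := A.ne_bot_iff.mp hbot
    exact exists_hasMinDist_of_word h1 (hammingNorm x) A hA ⟨x, hx, h0, by omega⟩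

/-- An upper bound on the dimension of the codes of length `w` and minimum distance exactly `δ`
also holds for the codes of length `w` whose nonzero words all have weight at least `δ`. -/
lemma finrank_le_of_forall_hasMinDist {ι F : Type*} [Field F] [DecidableEq F] [Fintype ι]
    {δ w : ℕ} {k : ℝ} (hw : Fintype.card ι = w) (h1 : 1 ≤ δ) (hι : δ ≤ w)
    (hk : ∀ A : Submodule F (Fin w → F), HasMinDist A δ → (Module.finrank F A : ℝ) ≤ k)
    (A : Submodule F (ι → F)) (hA : ∀ x ∈ A, x ≠ 0 → δ ≤ hammingNorm x) :
    (Module.finrank F A : ℝ) ≤ k := by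
  let e : Fin w ≃ ι := (Fintype.equivFinOfCardEq hw).symm
  let φ : (ι → F) ≃ₗ[F] (Fin w → F) := LinearEquiv.funCongrLeft F F e
  have hφ : ∀ x, hammingNorm (φ x) = hammingNorm x := by
    intro x
    refine Finset.card_equiv e fun i => ?_
    simp [φ, LinearEquiv.funCongrLeft, LinearMap.funLeft_apply]
  obtain ⟨A', hA', hle⟩ := exists_hasMinDist h1 (by simpa using hι)
    (A.map (φ : (ι → F) →ₗ[F] (Fin w → F))) (by
      rintro _ ⟨y, hy, rfl⟩ hy0
      have : hammingNorm (φ y) = hammingNorm y := hφ y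
      change δ ≤ hammingNorm (φ y)
      rw [this]
      exact hA y hy (by rintro rfl; exact hy0 (map_zero _)))
  rw [LinearEquiv.finrank_map_eq] at hle
  exact (Nat.cast_le.mpr hle).trans (hk A' hA')

variable {F ι K : Type*} [Field F] [Field K] [Algebra F K] [Fintype ι]

/-- The subfield subcode of a code of codimension `r` has codimension at most `r · [K : F]`. -/
lemma card_le_finrank_twistedSubcode_add [FiniteDimensional F K] (D : Submodule K (ι → K))
    (u : ι → Kˣ) :
    Fintype.card ι ≤ Module.finrank F (twistedSubcode F D u) +
      Module.finrank F K * (Fintype.card ι - Module.finrank K D) := by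
  let D' : Submodule F (ι → K) := D.restrictScalars F
  let ψ : (ι → F) →ₗ[F] (ι → K) :=
    LinearMap.pi fun i => (LinearMap.toSpanSingleton F K (u i : K)).comp (LinearMap.proj i)
  have hker : LinearMap.ker (D'.mkQ.comp ψ) = twistedSubcode F D u := by
    ext a
    rw [LinearMap.mem_ker, LinearMap.comp_apply, Submodule.mkQ_apply, Submodule.Quotient.mk_eq_zero,
      mem_twistedSubcode, Submodule.restrictScalars_mem]
    refine Iff.of_eq (congrArg (· ∈ D) (funext fun i => ?_))
    simp [ψ, Algebra.smul_def]
  have h1 := (D'.mkQ.comp ψ).finrank_range_add_finrank_ker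
  have h2 := Submodule.finrank_le (LinearMap.range (D'.mkQ.comp ψ))
  have h3 := Submodule.finrank_quotient_add_finrank D'
  have h4 : Module.finrank F D' = Module.finrank F K * Module.finrank K D :=
    (Module.finrank_mul_finrank F K D).symm
  have h5 : Module.finrank F (ι → K) = Module.finrank F K * Fintype.card ι := by
    rw [← Module.finrank_mul_finrank F K (ι → K), Module.finrank_fintype_fun_eq_card]
  rw [hker, Module.finrank_fintype_fun_eq_card] at h1
  rw [Nat.mul_sub]
  omega

end Dimension

/-! ### The sum over all column multipliers -/

section Sum

variable {F ι K : Type*} [Field F] [Field K] [Algebra F K] [Fintype ι] [DecidableEq ι]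
  [Fintype F] [Fintype K] [DecidableEq F] [DecidableEq K]

open Classical in
/-- The number of matrices without zero columns in the interleaved subfield subcodes of an MDS
code, summed over all column multipliers. -/
lemma sum_card_noZeroCols_le {D : Submodule K (ι → K)} {δ q m w s : ℕ} {k a b c : ℝ}
    (hw : Fintype.card ι = w) (hq : Fintype.card F = q) (hm : Module.finrank F K = m)
    (h1 : 1 ≤ δ) (hδw : δ ≤ w)
    (hδ : ∀ x ∈ D, x ≠ 0 → δ ≤ hammingNorm x)
    (hD : Fintype.card ι + 1 ≤ Module.finrank K D + δ)
    (hk : ∀ A : Submodule F (Fin w → F), HasMinDist A δ → (Module.finrank F A : ℝ) ≤ k)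
    (ha : a = max 1 ((q : ℝ) ^ ((w : ℤ) - ((δ : ℤ) - 1) * (m : ℤ)))) (hb : b = (q : ℝ) ^ k)
    (hc : c = ((q : ℝ) ^ m - 1) ^ w) :
    ∑ u : ι → Kˣ, ((Finset.univ.filter fun E : Fin s → ι → F =>
        (∀ i, E i ∈ twistedSubcode F D u) ∧ ∀ j, ∃ i, E i j ≠ 0).card : ℝ) ≤
      ((q : ℝ) ^ s - 1) / ((q : ℝ) - 1) * (c + mdsB q m w δ w - mdsBTotal q m w δ) - c +
        ((mdsBTotal q m w δ - c * a) / (b - a) + 1) * (b ^ s - a ^ s) + c * a ^ s := by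
  have : Nonempty ι := Fintype.card_pos_iff.mp (by omega)
  have hfin : FiniteDimensional F K := Module.Finite.of_finite
  have hQ : Fintype.card K = q ^ m := by rw [Module.card_eq_pow_finrank (K := F), hq, hm]
  have hq1 : (1 : ℝ) < q := by rw [← hq]; exact_mod_cast Fintype.one_lt_card
  have hTot := sum_card_twistedSubcode (F := F) hq hQ h1 hδ hD
  have hFull := sum_card_twistedSubcode_weight (F := F) hq hQ h1 hδ hD (hw ▸ hδw)
  rw [hw] at hFull
  rw [Nat.cast_sum] at hTot hFull
  have hcu : ∑ u : ι → Kˣ, (1 : ℝ) = c := by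
    rw [Finset.sum_const, Finset.card_univ, nsmul_eq_mul, mul_one, hc, Fintype.card_fun,
      Fintype.card_units, hQ, hw]
    push_cast [Nat.cast_sub (show 1 ≤ q ^ m from hQ ▸ Fintype.card_pos)]
    rfl
  set n : (ι → Kˣ) → ℝ := fun u =>
    ((Finset.univ.filter fun a : ι → F => a ∈ twistedSubcode F D u).card : ℝ)
  set f : (ι → Kˣ) → ℝ := fun u => ((Finset.univ.filter fun a : ι → F =>
    a ∈ twistedSubcode F D u ∧ hammingNorm a = Fintype.card ι).card : ℝ)
  have hsn : ∑ u, n u = mdsBTotal q m w δ := by rw [← hw]; exact hTot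
  have hsf : ∑ u, f u = mdsB q m w δ w := by simp only [f, hw]; exact hFull
  have hn : ∀ u, n u = (q : ℝ) ^ Module.finrank F (twistedSubcode F D u) := by
    intro u
    rw [← hq, ← Nat.cast_pow, ← Module.card_eq_pow_finrank, Fintype.card_subtype]
  have han : ∀ u, a ≤ n u := by
    intro u
    rw [hn, ha]
    refine max_le (one_le_pow₀ hq1.le) ?_
    rw [← zpow_natCast]
    refine zpow_le_zpow_right₀ hq1.le ?_
    have h := card_le_finrank_twistedSubcode_add (F := F) D u
    have h' : Module.finrank F K * (Fintype.card ι - Module.finrank K D) ≤ m * (δ - 1) := by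
      rw [hm]
      exact Nat.mul_le_mul_left m (by omega)
    have h'' : w ≤ Module.finrank F (twistedSubcode F D u) + m * (δ - 1) := by omega
    zify [h1] at h''
    linarith
  have hnb : ∀ u, n u ≤ b := by
    intro u
    rw [hn, hb, ← Real.rpow_natCast]
    refine Real.rpow_le_rpow_of_exponent_le hq1.le ?_
    refine finrank_le_of_forall_hasMinDist hw h1 hδw hk _ fun x hx h0 => ?_
    rw [← hammingNorm_algebraMap_mul (K := K) x u]
    refine hδ _ (mem_twistedSubcode.mp hx) ?_
    rwa [← hammingNorm_ne_zero_iff, hammingNorm_algebraMap_mul, hammingNorm_ne_zero_iff]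
  have ha1 : 1 ≤ a := ha ▸ le_max_left _ _
  have hab : a ≤ b := (han 1).trans (hnb 1)
  have hterm : ∀ u : ι → Kˣ, ((Finset.univ.filter fun E : Fin s → ι → F =>
        (∀ i, E i ∈ twistedSubcode F D u) ∧ ∀ j, ∃ i, E i j ≠ 0).card : ℝ) ≤
      (a ^ s + (n u - a) / (b - a) * (b ^ s - a ^ s)) - 1 -
        ((q : ℝ) ^ s - 1) / ((q : ℝ) - 1) * (n u - 1 - f u) := by
    intro u
    have e1 := card_noZeroCols_add_le (twistedSubcode F D u) s
    have e2 := congrArg (Nat.cast : ℕ → ℝ) (card_eq_add_card_full_weight (twistedSubcode F D u))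
    push_cast at e2
    have e3 := pow_le_secant (by linarith) (han u) (hnb u) s
    rw [hq] at e1
    have e4 : n u - 1 - f u = ((Finset.univ.filter fun a : ι → F =>
        a ∈ twistedSubcode F D u ∧ a ≠ 0 ∧ ∃ j, a j = 0).card : ℝ) := by
      simp only [n, f]
      linarith
    rw [e4]
    linarith
  refine (Finset.sum_le_sum fun u _ => hterm u).trans ?_
  have hsum : ∑ u : ι → Kˣ, ((a ^ s + (n u - a) / (b - a) * (b ^ s - a ^ s)) - 1 -
        ((q : ℝ) ^ s - 1) / ((q : ℝ) - 1) * (n u - 1 - f u)) =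
      c * a ^ s + (mdsBTotal q m w δ - c * a) / (b - a) * (b ^ s - a ^ s) - c -
        ((q : ℝ) ^ s - 1) / ((q : ℝ) - 1) * (mdsBTotal q m w δ - c - mdsB q m w δ w) := by
    have hcu' : ∀ z : ℝ, ∑ _u : ι → Kˣ, z = c * z := fun z => by
      rw [← hcu, Finset.sum_mul, one_mul]
    simp only [Finset.sum_sub_distrib, Finset.sum_add_distrib, ← Finset.mul_sum, ← Finset.sum_mul,
      ← Finset.sum_div, hcu', hsn, hsf]
    ring
  rw [hsum]
  have : a ^ s ≤ b ^ s := pow_le_pow_left₀ (by linarith) hab s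
  linarith

end Sum

/-! ### Generalized Reed-Solomon codes are MDS -/

section GRS

variable {ι K : Type*} [Field K]

lemma eq_zero_of_forall_sum_mul_pow_eq_zero {α : ι → K} (hα : Function.Injective α)
    {S : Finset ι} {y : ι → K} (h : ∀ l < S.card, ∑ j ∈ S, y j * α j ^ l = 0) :
    ∀ j ∈ S, y j = 0 := by
  intro j hj
  let e := S.equivFin
  have h0 : (fun i : Fin S.card => y (e.symm i)) = 0 := by
    refine Matrix.eq_zero_of_forall_pow_sum_mul_pow_eq_zero (f := fun i => α (e.symm i)) ?_ ?_
    · exact hα.comp (Subtype.val_injective.comp e.symm.injective)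
    · intro l
      rw [← h l l.isLt, ← Finset.sum_coe_sort S,
        ← e.symm.sum_comp fun j : S => y j * α j ^ (l : ℕ)]
  simpa using congrFun h0 (e ⟨j, hj⟩)

variable [Fintype ι] [DecidableEq ι]

lemma grsParityCheck_apply (α v : ι → K) (d : ℕ) (l : Fin (d - 1)) (j : ι) :
    grsParityCheck α v d l j = α j ^ (l : ℕ) * v j := by
  simp [grsParityCheck, locatorMatrix]

lemma mem_grsCode {α v : ι → K} {d : ℕ} {x : ι → K} :
    x ∈ grsCode α v d ↔ ∀ l < d - 1, ∑ j, v j * x j * α j ^ l = 0 := by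
  rw [grsCode, LinearMap.mem_ker, Matrix.mulVecLin_apply, funext_iff, Fin.forall_iff]
  refine forall₂_congr fun l hl => ?_
  simp only [Matrix.mulVec, dotProduct, grsParityCheck_apply, Pi.zero_apply]
  rw [Finset.sum_congr rfl fun j _ => show α j ^ l * v j * x j = v j * x j * α j ^ l by ring]

lemma le_hammingNorm_of_mem_grsCode [DecidableEq K] {α v : ι → K} (hα : Function.Injective α)
    (hv : ∀ j, v j ≠ 0) {d : ℕ} {x : ι → K} (hx : x ∈ grsCode α v d) (h0 : x ≠ 0) :
    d ≤ hammingNorm x := by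
  by_contra! hlt
  refine h0 (funext fun j => ?_)
  by_contra hj
  have h := eq_zero_of_forall_sum_mul_pow_eq_zero hα (S := Finset.univ.filter fun j => x j ≠ 0)
    (y := fun j => v j * x j) (fun l hl => by
      refine Eq.trans ?_ (mem_grsCode.mp hx l (by change l < hammingNorm x at hl; omega))
      refine Finset.sum_subset (Finset.filter_subset _ _) fun k _ hk => ?_
      have : x k = 0 := by simpa using hk
      simp [this]) j (by simpa using hj)
  exact mul_ne_zero (hv j) hj h

lemma card_add_one_le_finrank_grsCode_add (α v : ι → K) {d : ℕ} (hd : 1 ≤ d) :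
    Fintype.card ι + 1 ≤ Module.finrank K (grsCode α v d) + d := by
  have h1 := (grsParityCheck α v d).mulVecLin.finrank_range_add_finrank_ker
  have h2 := Submodule.finrank_le (LinearMap.range (grsParityCheck α v d).mulVecLin)
  rw [Module.finrank_fintype_fun_eq_card] at h1 h2
  rw [Fintype.card_fin] at h2
  rw [grsCode]
  omega

/-- Shortening: a word supported on `W` is in the GRS code if and only if its restriction to `W`
is in the GRS code with the locators and multipliers in `W`. -/
lemma mem_grsCode_iff_restrict {α v : ι → K} {d : ℕ} (W : Finset ι) {x : ι → K}
    (hx : ∀ j ∉ W, x j = 0) :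
    x ∈ grsCode α v d ↔
      (fun j : W => x j) ∈ grsCode (fun j : W => α j) (fun j : W => v j) d := by
  rw [mem_grsCode, mem_grsCode]
  refine forall₂_congr fun l _ => ?_
  rw [Finset.sum_coe_sort W fun j => v j * x j * α j ^ l,
    Finset.sum_subset (Finset.subset_univ W) fun j _ hj => by simp [hx j hj]]

end GRS

/-! ### Correctness of the joint decoder -/

section Decoder

variable {s : ℕ} {ι K : Type*} [Field K]

/-- The error locator polynomial `∏_{j ∈ P} (1 - α_j X)`. -/
def errorLocator (α : ι → K) (P : Finset ι) : K[X] :=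
  ∏ j ∈ P, (1 - C (α j) * X)

lemma eval_errorLocator_eq_zero {α : ι → K} (hα0 : ∀ j, α j ≠ 0) {P : Finset ι} {z : K} :
    (errorLocator α P).eval z = 0 ↔ ∃ j ∈ P, z = (α j)⁻¹ := by
  rw [errorLocator, eval_prod, Finset.prod_eq_zero_iff]
  refine exists_congr fun j => and_congr_right fun _ => ?_
  rw [eval_sub, eval_one, eval_C_mul, eval_X, sub_eq_zero, eq_comm, mul_comm,
    mul_eq_one_iff_eq_inv₀ (hα0 j)]

lemma ncard_roots_errorLocator {α : ι → K} (hα : Function.Injective α) (hα0 : ∀ j, α j ≠ 0)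
    (P : Finset ι) : {z : K | (errorLocator α P).IsRoot z}.ncard = P.card := by
  have : {z : K | (errorLocator α P).IsRoot z} = (fun j => (α j)⁻¹) '' P := by
    ext z
    rw [Set.mem_ofPred_eq, IsRoot.def, eval_errorLocator_eq_zero hα0]
    simp [eq_comm]
  rw [this, Set.ncard_image_of_injective _ fun i j h => hα (inv_injective h), Set.ncard_coe_finset]

lemma natDegree_errorLocator_le (α : ι → K) (P : Finset ι) :
    (errorLocator α P).natDegree ≤ P.card := by
  refine (natDegree_prod_le _ _).trans ?_
  refine (Finset.sum_le_card_nsmul P _ 1 fun j _ => ?_).trans (by simp)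
  compute_degree

/-- The coefficients of a polynomial of degree at most `t` with constant term one, in the order
used by the key equation. -/
lemma locatorPoly_coeff {L : K[X]} {t : ℕ} (h0 : L.coeff 0 = 1) (ht : L.natDegree ≤ t) :
    locatorPoly (fun k : Fin t => L.coeff (t - k)) = L := by
  conv_rhs => rw [L.as_sum_range_C_mul_X_pow' (Nat.lt_succ_of_le ht), Finset.sum_range_succ', h0]
  rw [locatorPoly, add_comm, map_one, pow_zero, one_mul,
    ← Finset.sum_range_reflect, Finset.sum_range]
  congr 1
  refine Finset.sum_congr rfl fun k _ => ?_
  rw [show t - 1 - (k : ℕ) + 1 = t - k by omega]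

lemma jointDecode_of_unique [Fintype ι] [DecidableEq ι] {α v : ι → K} {d τ : ℕ}
    {R : Matrix (Fin s) ι K} (hS : syndromes α v d R ≠ 0)
    (hτ : keyDegree (syndromes α v d R) = τ) {x : Fin τ → K}
    (hx : SolvesKey (syndromes α v d R) τ x)
    (huniq : ∀ y, SolvesKey (syndromes α v d R) τ y → y = x)
    (hroots : {z : K | (locatorPoly x).IsRoot z}.ncard = τ) :
    jointDecode α v d R = some (R - forney α v (syndromes α v d R) (locatorPoly x)) := by
  subst hτ
  have h : ∃! x, SolvesKey (syndromes α v d R) (keyDegree (syndromes α v d R)) x := ⟨x, hx, huniq⟩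
  have hc : h.choose = x := huniq _ h.choose_spec.1
  rw [jointDecode, if_neg hS, dif_pos h, hc, if_pos hroots]

variable [Fintype ι] [DecidableEq ι]

lemma syndromes_apply (α v : ι → K) (d : ℕ) (R : Matrix (Fin s) ι K) (i : Fin s)
    (l : Fin (d - 1)) : syndromes α v d R i l = ∑ j, v j * R i j * α j ^ (l : ℕ) := by
  rw [syndromes, Matrix.mul_apply]
  refine Finset.sum_congr rfl fun j _ => ?_
  rw [Matrix.transpose_apply, grsParityCheck_apply]
  ring

lemma syndromes_add_of_mem {α v : ι → K} {d : ℕ} {M : Matrix (Fin s) ι K}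
    (hM : ∀ i, M i ∈ grsCode α v d) (E : Matrix (Fin s) ι K) :
    syndromes α v d (M + E) = syndromes α v d E := by
  ext i l
  rw [syndromes_apply, syndromes_apply]
  have := mem_grsCode.mp (hM i) l l.isLt
  simp only [Matrix.add_apply, mul_add, add_mul, Finset.sum_add_distrib]
  rw [this, zero_add]

/-- The key matrix is the product of the parity-check matrix of a GRS code, the error values, and
a Vandermonde matrix. -/
lemma keyMatrix_mulVec_syndromes (α v : ι → K) (d t : ℕ) (E : Matrix (Fin s) ι K) (y : Fin t → K)
    (p : Fin s × Fin (d - 1 - t)) :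
    (keyMatrix (syndromes α v d E) t).mulVec y p =
      ∑ j, v j * (E p.1 j * ∑ k, y k * α j ^ (k : ℕ)) * α j ^ (p.2 : ℕ) := by
  simp only [Matrix.mulVec, dotProduct, keyMatrix, Matrix.of_apply, syndromes_apply,
    Finset.sum_mul, Finset.mul_sum]
  rw [Finset.sum_comm]
  refine Finset.sum_congr rfl fun j _ => Finset.sum_congr rfl fun k _ => ?_
  ring

variable {α v : ι → K} {d t : ℕ} {E : Matrix (Fin s) ι K} {P : Finset ι}

lemma eq_zero_of_keyMatrix_mulVec_eq_zero (hα : Function.Injective α) (hP : P.card = t)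
    (hE : ∀ i, ∀ j ∉ P, E i j = 0)
    (hinj : ∀ c : ι → K, (∀ j ∉ P, c j = 0) →
      (∀ i, (fun j => E i j * c j) ∈ grsCode α v (d - t)) → c = 0)
    {y : Fin t → K} (hy : (keyMatrix (syndromes α v d E) t).mulVec y = 0) : y = 0 := by
  have hc := hinj (fun j => if j ∈ P then ∑ k, y k * α j ^ (k : ℕ) else 0)
    (fun j hj => if_neg hj) fun i => by
      rw [mem_grsCode]
      intro l hl
      have := congrFun hy (i, ⟨l, by omega⟩)
      rw [keyMatrix_mulVec_syndromes] at this
      rw [← Pi.zero_apply (M := fun _ => K) (i, (⟨l, by omega⟩ : Fin (d - 1 - t))), ← this]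
      refine Finset.sum_congr rfl fun j _ => ?_
      by_cases hj : j ∈ P
      · simp only [if_pos hj]
      · simp [hE i j hj]
  let e : Fin t ≃ P := (P.equivFinOfCardEq hP).symm
  refine Matrix.eq_zero_of_forall_index_sum_mul_pow_eq_zero (f := fun k => α (e k))
    (hα.comp (Subtype.val_injective.comp e.injective)) fun k => ?_
  have := congrFun hc (e k)
  rwa [if_pos (e k).2] at this

/-- A solution `x` of the key equation of degree `τ < t` gives the nonzero kernel vector
`(x, 1, 0, …, 0)` of the key matrix of degree `t`. -/
lemma exists_keyMatrix_mulVec_eq_zero {τ : ℕ} (hτ : τ < t) {x : Fin τ → K}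
    (hx : SolvesKey (syndromes α v d E) τ x) :
    ∃ y ≠ 0, (keyMatrix (syndromes α v d E) t).mulVec y = 0 := by
  let g : ℕ → K := fun k => if h : k < τ then x ⟨k, h⟩ else if k = τ then 1 else 0
  refine ⟨fun k => g k, ?_, ?_⟩
  · intro h
    have := congrFun h ⟨τ, hτ⟩
    simp [g] at this
  · funext p
    obtain ⟨i, r, hr⟩ := p
    have h1 := congrFun hx (i, ⟨r, by omega⟩)
    rw [keyMatrix_mulVec_syndromes, keyVector, syndromes_apply] at h1
    have hg : ∀ j, ∑ k : Fin t, g k * α j ^ (k : ℕ) =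
        ∑ k : Fin τ, x k * α j ^ (k : ℕ) + α j ^ τ := by
      intro j
      rw [← Finset.sum_range fun k => g k * α j ^ k,
        ← Finset.sum_subset (Finset.range_mono (show τ + 1 ≤ t from hτ)), Finset.sum_range_succ,
        Finset.sum_range]
      · simp [g]
      · intro k _ hk
        rw [Finset.mem_range] at hk
        simp [g, show ¬ k < τ by omega, show k ≠ τ by omega]
    rw [keyMatrix_mulVec_syndromes]
    simp only at h1 ⊢
    rw [Pi.zero_apply, ← neg_add_cancel (∑ j, v j * E i j * α j ^ (τ + r)), ← h1,
      ← Finset.sum_add_distrib]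
    refine Finset.sum_congr rfl fun j _ => ?_
    rw [hg]
    ring

lemma solvesKey_errorLocator (hα0 : ∀ j, α j ≠ 0) (hE : ∀ i, ∀ j ∉ P, E i j = 0) {x : Fin t → K}
    (hx : locatorPoly x = errorLocator α P) : SolvesKey (syndromes α v d E) t x := by
  funext p
  rw [keyMatrix_mulVec_syndromes, keyVector, syndromes_apply, ← Finset.sum_neg_distrib]
  refine Finset.sum_congr rfl fun j _ => ?_
  by_cases hj : j ∈ P
  · have h0 := (eval_errorLocator_eq_zero hα0 (P := P) (z := (α j)⁻¹)).mpr ⟨j, hj, rfl⟩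
    rw [← hx, locatorPoly, eval_add, eval_one, eval_finsetSum] at h0
    simp only [eval_C_mul, eval_pow, eval_X] at h0
    have h1 : ∑ k : Fin t, x k * α j ^ (k : ℕ) = - α j ^ t := by
      have h2 : α j ^ t * ∑ k : Fin t, x k * (α j)⁻¹ ^ (t - (k : ℕ)) =
          ∑ k : Fin t, x k * α j ^ (k : ℕ) := by
        rw [Finset.mul_sum]
        refine Finset.sum_congr rfl fun k _ => ?_
        have h3 : α j ^ t = α j ^ (k : ℕ) * α j ^ (t - (k : ℕ)) := by
          rw [← pow_add, Nat.add_sub_cancel' k.isLt.le]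
        have := pow_ne_zero (t - (k : ℕ)) (hα0 j)
        rw [h3, inv_pow]
        field_simp
      rw [← h2]
      linear_combination α j ^ t * h0
    rw [h1]
    simp only [pow_add]
    ring
  · simp [hE _ j hj]

/-- The error evaluator, `∑_{j ∈ P} E_j v_j ∏_{k ≠ j} (1 - α_k X)`. -/
lemma errorEvaluator_syndromes (htd : P.card < d) (hE : ∀ i, ∀ j ∉ P, E i j = 0) (i : Fin s) :
    errorEvaluator (syndromes α v d E i) (errorLocator α P) =
      ∑ j ∈ P, C (v j * E i j) * errorLocator α (P.erase j) := by
  have hsyn : ∑ l : Fin (d - 1), C (syndromes α v d E i l) * X ^ (l : ℕ) =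
      ∑ j ∈ P, C (v j * E i j) * ∑ l ∈ Finset.range (d - 1), (C (α j) * X) ^ l := by
    have : ∀ l : Fin (d - 1), syndromes α v d E i l = ∑ j ∈ P, v j * E i j * α j ^ (l : ℕ) := by
      intro l
      rw [syndromes_apply]
      refine (Finset.sum_subset (Finset.subset_univ P) fun j _ hj => ?_).symm
      simp [hE i j hj]
    simp only [this, map_sum, Finset.sum_mul, Finset.mul_sum, Finset.sum_range]
    rw [Finset.sum_comm]
    refine Finset.sum_congr rfl fun j _ => Finset.sum_congr rfl fun l _ => ?_
    rw [C_mul, C_pow, mul_pow]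
    ring
  refine (div_modByMonic_unique
    (-∑ j ∈ P, C (v j * E i j) * C (α j) ^ (d - 1) * errorLocator α (P.erase j)) _
    (monic_X_pow (d - 1)) ⟨?_, ?_⟩).2
  · rw [hsyn, Finset.sum_mul, mul_neg, ← sub_eq_add_neg, Finset.mul_sum, ← Finset.sum_sub_distrib]
    refine Finset.sum_congr rfl fun j hj => ?_
    have h1 : errorLocator α P = (1 - C (α j) * X) * errorLocator α (P.erase j) :=
      (Finset.mul_prod_erase P _ hj).symm
    have h2 := geom_sum_mul_neg (C (α j) * X) (d - 1)
    rw [mul_pow] at h2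
    rw [h1]
    linear_combination (-C (v j * E i j) * errorLocator α (P.erase j)) * h2
  · rw [degree_X_pow, ← mem_degreeLT]
    refine Submodule.sum_mem _ fun j hj => ?_
    rw [mem_degreeLT]
    refine degree_le_natDegree.trans_lt (Nat.cast_lt.mpr ?_)
    refine (natDegree_C_mul_le _ _).trans_lt ((natDegree_errorLocator_le _ _).trans_lt ?_)
    have := Finset.card_pos.mpr ⟨j, hj⟩
    rw [Finset.card_erase_of_mem hj]
    omega

/-- Forney's formula recovers the error from its locator polynomial. -/
lemma forney_eq (hα : Function.Injective α) (hα0 : ∀ j, α j ≠ 0) (hv : ∀ j, v j ≠ 0)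
    (htd : P.card < d) (hE : ∀ i, ∀ j ∉ P, E i j = 0) :
    forney α v (syndromes α v d E) (errorLocator α P) = E := by
  ext i j
  rw [forney, Matrix.of_apply]
  by_cases hj : j ∈ P
  · rw [if_pos ((eval_errorLocator_eq_zero hα0).mpr ⟨j, hj, rfl⟩),
      errorEvaluator_syndromes htd hE]
    have hz : ∀ k ∈ P, k ≠ j → (errorLocator α (P.erase k)).eval (α j)⁻¹ = 0 := fun k _ hk =>
      (eval_errorLocator_eq_zero hα0).mpr ⟨j, Finset.mem_erase.mpr ⟨hk.symm, hj⟩, rfl⟩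
    have hnz : (errorLocator α (P.erase j)).eval (α j)⁻¹ ≠ 0 := by
      rw [Ne, eval_errorLocator_eq_zero hα0]
      rintro ⟨k, hk, h⟩
      exact (Finset.mem_erase.mp hk).1 (hα (inv_injective h)).symm
    have h1 : (∑ k ∈ P, C (v k * E i k) * errorLocator α (P.erase k)).eval (α j)⁻¹ =
        v j * E i j * (errorLocator α (P.erase j)).eval (α j)⁻¹ := by
      rw [eval_finsetSum, Finset.sum_eq_single_of_mem j hj, eval_C_mul]
      intro k hk hkj
      rw [eval_mul, hz k hk hkj, mul_zero]
    have h2 : (derivative (errorLocator α P)).eval (α j)⁻¹ =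
        -α j * (errorLocator α (P.erase j)).eval (α j)⁻¹ := by
      rw [errorLocator, derivative_prod_finset, eval_finsetSum, Finset.sum_eq_single_of_mem j hj]
      · rw [eval_mul, ← errorLocator]
        simp only [derivative_sub, derivative_one, derivative_C_mul_X, zero_sub, eval_neg, eval_C]
        ring
      · intro k hk hkj
        rw [eval_mul, ← errorLocator, hz k hk hkj, zero_mul]
    rw [h1, h2]
    have hα' := hα0 j
    have hv' := hv j
    generalize (errorLocator α (P.erase j)).eval (α j)⁻¹ = e at hnz
    field_simp
  · rw [if_neg, hE i j hj]
    rw [eval_errorLocator_eq_zero hα0]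
    rintro ⟨k, hk, h⟩
    exact hj (hα (inv_injective h) ▸ hk)

/-- The decoder succeeds when no nonzero vector `c` supported on the error positions multiplies
all rows of the error into the GRS code of designed distance `d - t`. -/
lemma jointDecode_add_eq (hα : Function.Injective α) (hα0 : ∀ j, α j ≠ 0) (hv : ∀ j, v j ≠ 0)
    (hP : P.card = t) (htd : t < d) (hE : ∀ i, ∀ j ∉ P, E i j = 0)
    (hinj : ∀ c : ι → K, (∀ j ∉ P, c j = 0) →
      (∀ i, (fun j => E i j * c j) ∈ grsCode α v (d - t)) → c = 0)
    {M : Matrix (Fin s) ι K} (hM : ∀ i, M i ∈ grsCode α v d) :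
    jointDecode α v d (M + E) = some M := by
  have hker := fun y => eq_zero_of_keyMatrix_mulVec_eq_zero (y := y) hα hP hE hinj
  -- the syndromes vanish only if there are no errors, since the key matrix is injective
  by_cases hS : syndromes α v d E = 0
  · have ht : t = 0 := by
      by_contra ht
      have := hker 1 (by
        rw [hS]
        ext p
        simp [keyMatrix, Matrix.mulVec, dotProduct])
      exact one_ne_zero (congrFun this ⟨0, Nat.pos_of_ne_zero ht⟩)
    rw [ht, Finset.card_eq_zero] at hP
    have hE0 : E = 0 := by
      ext i j
      exact hE i j (by simp [hP])
    rw [jointDecode, syndromes_add_of_mem hM, if_pos hS, hE0, add_zero]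
  · have hloc : locatorPoly (fun k : Fin t => (errorLocator α P).coeff (t - k)) =
        errorLocator α P := by
      refine locatorPoly_coeff ?_ (hP ▸ natDegree_errorLocator_le α P)
      rw [coeff_zero_eq_eval_zero, errorLocator, eval_prod]
      simp
    have hsol := solvesKey_errorLocator (v := v) (d := d) hα0 hE hloc
    have hdeg : keyDegree (syndromes α v d E) = t := by
      refine le_antisymm (Nat.sInf_le ⟨_, hsol⟩) ?_
      by_contra! hlt
      obtain ⟨x, hx⟩ := Nat.sInf_mem (solvesKey_nonempty (syndromes α v d E))
      obtain ⟨y, hy0, hy⟩ := exists_keyMatrix_mulVec_eq_zero hlt hx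
      exact hy0 (hker y hy)
    have hsyn := syndromes_add_of_mem hM E
    rw [jointDecode_of_unique (τ := t) (by rwa [hsyn]) (by rwa [hsyn]) (by rw [hsyn]; exact hsol)
      (fun y hy => ?_) (by rw [hloc, ncard_roots_errorLocator hα hα0, hP]), hsyn, hloc,
      forney_eq hα hα0 hv (hP ▸ htd) hE, add_sub_cancel_right]
    rw [hsyn] at hy
    refine sub_eq_zero.mp (hker _ ?_)
    rw [Matrix.mulVec_sub, hy, hsol, sub_self]

end Decoder

/-! ### The union bound over supports and multipliers -/

section UnionBound

variable {F K κ : Type*} [Field F] [Field K] [Algebra F K] [Fintype F] [Fintype K]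
  [DecidableEq F] [DecidableEq K] [Fintype κ] [DecidableEq κ]

lemma card_forall_exists_ne_zero (κ F : Type*) [Field F] [Fintype F] [DecidableEq F] [Fintype κ]
    [DecidableEq κ] (s : ℕ) :
    (Finset.univ.filter fun E : Fin s → κ → F => ∀ j, ∃ i, E i j ≠ 0).card =
      (Fintype.card F ^ s - 1) ^ Fintype.card κ := by
  have h : (Finset.univ.erase (0 : Fin s → F)).card = Fintype.card F ^ s - 1 := by
    rw [Finset.card_erase_of_mem (Finset.mem_univ _), Finset.card_univ]
    simp
  rw [← h]
  have h' := Finset.card_equiv (Equiv.piComm fun (_ : Fin s) (_ : κ) => F)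
    (s := Finset.univ.filter fun E : Fin s → κ → F => ∀ j, ∃ i, E i j ≠ 0)
    (t := Fintype.piFinset fun _ : κ => Finset.univ.erase (0 : Fin s → F)) fun E => by
      simp [Fintype.mem_piFinset, Function.ne_iff]
  rw [h', Fintype.card_piFinset, Finset.prod_const, Finset.card_univ]

open Classical in
/-- A condition on the columns in `W` leaves the other columns free. -/
lemma card_filter_restrict (W : Finset κ) (s : ℕ) (p : (Fin s → W → F) → Prop) :
    (Finset.univ.filter fun E : Fin s → κ → F =>
      (∀ j, ∃ i, E i j ≠ 0) ∧ p fun i j => E i j).card =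
    (Finset.univ.filter fun E : Fin s → W → F => p E ∧ ∀ j, ∃ i, E i j ≠ 0).card *
      (Fintype.card F ^ s - 1) ^ (Fintype.card κ - W.card) := by
  have hc : Fintype.card {j // j ∉ W} = Fintype.card κ - W.card := by
    rw [Fintype.card_subtype_compl, Fintype.card_coe]
  rw [← hc, ← card_forall_exists_ne_zero, ← Finset.card_product]
  refine Finset.card_nbij'
    (fun E => (fun i (j : W) => E i j, fun i (j : {j // j ∉ W}) => E i j))
    (fun p i j => if h : j ∈ W then p.1 i ⟨j, h⟩ else p.2 i ⟨j, h⟩) ?_ ?_ ?_ ?_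
  · intro E hE
    have hE := (Finset.mem_filter.mp hE).2
    simp only [Finset.coe_product, Set.mem_prod, Finset.coe_filter, Finset.mem_univ, true_and,
      Set.mem_ofPred_eq]
    exact ⟨⟨hE.2, fun j => hE.1 j⟩, fun j => hE.1 j⟩
  · rintro ⟨E, E'⟩ hE
    simp only [Finset.coe_product, Set.mem_prod, Finset.coe_filter, Finset.mem_univ, true_and,
      Set.mem_ofPred_eq] at hE ⊢
    refine ⟨fun j => ?_, ?_⟩
    · by_cases h : j ∈ W
      · simpa [h] using hE.1.2 ⟨j, h⟩
      · simpa [h] using hE.2 ⟨j, h⟩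
    · convert! hE.1.1 using 3 with i j
      simp
  · intro E _
    funext i j
    by_cases h : j ∈ W <;> simp [h]
  · rintro ⟨E, E'⟩ _
    refine Prod.ext ?_ ?_
    · funext i j
      simp
    · funext i j
      simp [j.2]

open Classical in
/-- Vectors with support `W` correspond to the vectors of units indexed by `W`. -/
lemma sum_filter_support {R : Type*} [AddCommMonoid R] (W : Finset κ) (f : (κ → K) → R) :
    ∑ c ∈ Finset.univ.filter (fun c : κ → K => (Finset.univ.filter fun j => c j ≠ 0) = W), f c =
      ∑ u : W → Kˣ, f fun j => if h : j ∈ W then (u ⟨j, h⟩ : K) else 0 := by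
  have hmem : ∀ c : κ → K, (Finset.univ.filter fun j => c j ≠ 0) = W → ∀ j, c j ≠ 0 ↔ j ∈ W := by
    rintro c rfl j
    simp
  symm
  refine Finset.sum_bij (fun u _ j => if h : j ∈ W then (u ⟨j, h⟩ : K) else 0) ?_ ?_ ?_ ?_
  · intro u _
    simp only [Finset.mem_filter, Finset.mem_univ, true_and]
    ext j
    by_cases h : j ∈ W <;> simp [h]
  · intro u _ u' _ h
    funext j
    have := congrFun h j
    simpa [Units.ext_iff] using this
  · intro c hc
    have hc := hmem c (Finset.mem_filter.mp hc).2
    refine ⟨fun j => Units.mk0 (c j) ((hc j).mpr j.2), Finset.mem_univ _, ?_⟩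
    funext j
    by_cases h : j ∈ W
    · simp [h]
    · have := (not_congr (hc j)).mpr h
      simp only [dif_neg h]
      exact (not_not.mp this).symm
  · intro u _
    rfl

open Classical in
/-- Every bad error matrix has at least `|K| - 1` vectors `c` witnessing that it is bad, namely
the nonzero multiples of one of them. -/
lemma card_bad_mul_le (s : ℕ) (D : Submodule K (κ → K)) :
    (Fintype.card K - 1) * (Finset.univ.filter fun E : Fin s → κ → F =>
      (∀ j, ∃ i, E i j ≠ 0) ∧
        ∃ c : κ → K, c ≠ 0 ∧ ∀ i, (fun j => algebraMap F K (E i j) * c j) ∈ D).card ≤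
    ∑ c ∈ Finset.univ.filter (fun c : κ → K => c ≠ 0),
      (Finset.univ.filter fun E : Fin s → κ → F =>
        (∀ j, ∃ i, E i j ≠ 0) ∧ ∀ i, (fun j => algebraMap F K (E i j) * c j) ∈ D).card := by
  have hswap : ∑ c ∈ Finset.univ.filter (fun c : κ → K => c ≠ 0),
      (Finset.univ.filter fun E : Fin s → κ → F =>
        (∀ j, ∃ i, E i j ≠ 0) ∧ ∀ i, (fun j => algebraMap F K (E i j) * c j) ∈ D).card =
      ∑ E : Fin s → κ → F, ((Finset.univ.filter fun c : κ → K => c ≠ 0).filter fun c =>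
        (∀ j, ∃ i, E i j ≠ 0) ∧ ∀ i, (fun j => algebraMap F K (E i j) * c j) ∈ D).card :=
    Finset.sum_card_bipartiteAbove_eq_sum_card_bipartiteBelow fun (c : κ → K) (E : Fin s → κ → F) =>
      (∀ j, ∃ i, E i j ≠ 0) ∧ ∀ i, (fun j => algebraMap F K (E i j) * c j) ∈ D
  rw [hswap, mul_comm, ← smul_eq_mul]
  refine (Finset.card_nsmul_le_sum _ _ _ fun E hE => ?_).trans
    (Finset.sum_le_sum_of_subset (Finset.filter_subset _ _))
  obtain ⟨hnz, c, hc, hcD⟩ := (Finset.mem_filter.mp hE).2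
  obtain ⟨j, hj⟩ := Function.ne_iff.mp hc
  rw [← Fintype.card_units, ← Finset.card_univ]
  refine Finset.card_le_card_of_injOn (fun u : Kˣ => (u : K) • c) ?_ ?_
  · intro u _
    simp only [Finset.coe_filter, Finset.mem_filter, Finset.mem_univ, true_and, Set.mem_ofPred_eq]
    refine ⟨smul_ne_zero u.ne_zero hc, hnz, fun i => ?_⟩
    convert! D.smul_mem (u : K) (hcD i) using 1
    funext j
    simp only [Pi.smul_apply, smul_eq_mul]
    ring
  · intro u _ u' _ h
    exact Units.ext (mul_right_cancel₀ hj (congrFun h j))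

open Classical in
/-- The number of error matrices without zero columns for which a nonzero `c` multiplies all rows
into the GRS code, in terms of bounds `B w` for the vectors `c` with a given support of
size `w`. -/
lemma mul_card_bad_le_sum {t δ s : ℕ} (hκ : Fintype.card κ = t)
    {α v : κ → K} (hα : Function.Injective α) (hv : ∀ j, v j ≠ 0) (B : ℕ → ℝ)
    (hB : ∀ W : Finset κ, δ ≤ W.card →
      ∑ u : W → Kˣ, ((Finset.univ.filter fun E : Fin s → W → F =>
        (∀ i, E i ∈ twistedSubcode F (grsCode (fun j : W => α j) (fun j : W => v j) δ) u) ∧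
          ∀ j, ∃ i, E i j ≠ 0).card : ℝ) ≤ B W.card) :
    ((Fintype.card K : ℝ) - 1) * (Finset.univ.filter fun E : Fin s → κ → F =>
      (∀ j, ∃ i, E i j ≠ 0) ∧
        ∃ c : κ → K, c ≠ 0 ∧
          ∀ i, (fun j => algebraMap F K (E i j) * c j) ∈ grsCode α v δ).card ≤
    ∑ w ∈ Finset.Icc δ t, (t.choose w : ℝ) *
      (B w * ((Fintype.card F : ℝ) ^ s - 1) ^ (t - w)) := by
  have hqs : 1 ≤ Fintype.card F ^ s := Nat.one_le_pow _ _ Fintype.card_pos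
  have hqs' : (0 : ℝ) ≤ (Fintype.card F : ℝ) ^ s - 1 := sub_nonneg.mpr (by exact_mod_cast hqs)
  have h0 := (Nat.cast_le (α := ℝ)).mpr (card_bad_mul_le (F := F) s (grsCode α v δ))
  rw [Nat.cast_mul, Nat.cast_sub Fintype.card_pos, Nat.cast_one, Nat.cast_sum] at h0
  refine h0.trans ?_
  rw [← Finset.sum_fiberwise _ fun c : κ → K => Finset.univ.filter fun j => c j ≠ 0]
  set N : (κ → K) → ℝ := fun c => ((Finset.univ.filter fun E : Fin s → κ → F =>
    (∀ j, ∃ i, E i j ≠ 0) ∧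
      ∀ i, (fun j => algebraMap F K (E i j) * c j) ∈ grsCode α v δ).card : ℝ)
  have hW : ∀ W : Finset κ, ∑ c ∈ (Finset.univ.filter fun c : κ → K => c ≠ 0).filter
      (fun c : κ → K => (Finset.univ.filter fun j => c j ≠ 0) = W), N c ≤
      if δ ≤ W.card then B W.card * ((Fintype.card F : ℝ) ^ s - 1) ^ (t - W.card) else 0 := by
    intro W
    split_ifs with hδ
    · calc _ ≤ ∑ c ∈ Finset.univ.filter
            (fun c : κ → K => (Finset.univ.filter fun j => c j ≠ 0) = W), N c :=
          Finset.sum_le_sum_of_subset_of_nonneg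
            (Finset.filter_subset_filter _ (Finset.filter_subset _ _))
            fun _ _ _ => Nat.cast_nonneg _
        _ = ∑ u : W → Kˣ, ((Finset.univ.filter fun E : Fin s → W → F =>
              (∀ i, E i ∈ twistedSubcode F (grsCode (fun j : W => α j) (fun j : W => v j) δ) u) ∧
              ∀ j, ∃ i, E i j ≠ 0).card : ℝ) *
              ((Fintype.card F : ℝ) ^ s - 1) ^ (t - W.card) := by
          rw [sum_filter_support W N]
          refine Finset.sum_congr rfl fun u _ => ?_
          have h := card_filter_restrict W s fun E : Fin s → W → F =>
            ∀ i, E i ∈ twistedSubcode F (grsCode (fun j : W => α j) (fun j : W => v j) δ) u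
          rw [hκ] at h
          have h := congrArg (Nat.cast : ℕ → ℝ) h
          rw [Nat.cast_mul, Nat.cast_pow, Nat.cast_sub hqs, Nat.cast_pow, Nat.cast_one] at h
          refine Eq.trans (congrArg Nat.cast (congrArg Finset.card ?_)) (h.trans (by congr!))
          ext E
          simp only [Finset.mem_filter, Finset.mem_univ, true_and, mem_twistedSubcode]
          refine and_congr_right fun _ => forall_congr' fun i => ?_
          rw [mem_grsCode_iff_restrict W fun j hj => by simp [hj]]
          simp
        _ ≤ _ := by
          rw [← Finset.sum_mul]
          exact mul_le_mul_of_nonneg_right (hB W hδ) (pow_nonneg hqs' _)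
    · refine (Finset.sum_eq_zero fun c hc => ?_).le
      rw [Finset.mem_filter, Finset.mem_filter] at hc
      simp only [N, Nat.cast_eq_zero, Finset.card_eq_zero, Finset.filter_eq_empty_iff,
        Finset.mem_univ, forall_const]
      rintro E ⟨hE, hcE⟩
      -- some row of the error is nonzero at a place where `c` is nonzero
      obtain ⟨j, hj⟩ := Function.ne_iff.mp hc.1.2
      obtain ⟨i, hi⟩ := hE j
      have h1 := le_hammingNorm_of_mem_grsCode hα hv (hcE i) (Function.ne_iff.mpr
        ⟨j, mul_ne_zero ((_root_.map_ne_zero _).mpr hi) hj⟩)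
      have h2 : hammingNorm (fun j => algebraMap F K (E i j) * c j) ≤ W.card := by
        rw [← hc.2]
        refine Finset.card_le_card fun k hk => ?_
        simp only [Finset.mem_filter, Finset.mem_univ, true_and] at hk ⊢
        exact right_ne_zero_of_mul hk
      omega
  refine (Finset.sum_le_sum fun W _ => hW W).trans (le_of_eq ?_)
  rw [← Finset.powerset_univ, Finset.sum_powerset_apply_card fun w =>
    if δ ≤ w then B w * ((Fintype.card F : ℝ) ^ s - 1) ^ (t - w) else 0, Finset.card_univ, hκ]
  symm
  refine Finset.sum_subset_zero_on_sdiff (fun w hw => ?_) (fun w hw => ?_) fun w hw => ?_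
  · rw [Finset.mem_Icc] at hw
    rw [Finset.mem_range]
    omega
  · rw [Finset.mem_sdiff, Finset.mem_range, Finset.mem_Icc] at hw
    rw [if_neg (by omega), smul_zero]
  · rw [Finset.mem_Icc] at hw
    rw [if_pos hw.1, nsmul_eq_mul]

end UnionBound

/-! ### The success probability -/

section Success

variable {F K ι : Type*} [Field F] [Field K] [Algebra F K] [Fintype ι] [DecidableEq ι]

/-- Decoding fails only if some nonzero `c` multiplies all rows of the error into a GRS code. -/
lemma decodingSucceeds_of_forall {s d t : ℕ} {α v : ι → K} (hα : Function.Injective α)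
    (hα0 : ∀ j, α j ≠ 0) (hv : ∀ j, v j ≠ 0) {P : Finset ι} (hP : P.card = t) (htd : t < d)
    {M : Matrix (Fin s) ι F} (hM : M ∈ interleavedCode s (alternantCode F α v d))
    {E : Matrix (Fin s) P F}
    (hE : ∀ c : P → K, (∀ i, (fun j => algebraMap F K (E i j) * c j) ∈
      grsCode (fun j : P => α j) (fun j : P => v j) (d - t)) → c = 0) :
    DecodingSucceeds α v d M P E := by
  have hmap : (M + burst P E).map (algebraMap F K) =
      M.map (algebraMap F K) + (burst P E).map (algebraMap F K) :=
    Matrix.map_add _ (map_add _) _ _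
  rw [DecodingSucceeds, hmap]
  refine jointDecode_add_eq hα hα0 hv hP htd (P := P) ?_ ?_ fun i => hM i
  · intro i j hj
    simp [burst, hj]
  · intro c hc h
    have := hE (fun j => c j) fun i => by
      have := (mem_grsCode_iff_restrict P fun j hj => by simp [hc j hj]).mp (h i)
      simpa [burst] using this
    funext j
    by_cases hj : j ∈ P
    · exact congrFun this ⟨j, hj⟩
    · exact hc j hj

end Success

end IntAlt

end

/-! ### The lower bound on the success probability -/

theorem mainTheorem8
    {F K : Type*} [Field F] [Field K] [Fintype F] [Fintype K] [DecidableEq F] [DecidableEq K]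
    [Algebra F K] (q m : ℕ) (hq : Fintype.card F = q) (hm : Module.finrank F K = m)
    (n s d t : ℕ) (hs : 0 < s)
    (α : Fin n → K) (hα : Function.Injective α) (hα0 : ∀ j, α j ≠ 0)
    (v : Fin n → K) (hv : ∀ j, v j ≠ 0)
    (P : Finset (Fin n)) (hP : P.card = t) (htd : t < d) :
    -- the numbers `B^MDS` are those of any MDS code of length `w` and minimum distance `d - t`
    (∀ w ∈ Finset.Icc (d - t) t, ∀ D : Submodule K (Fin w → K), IntAlt.IsMDS D (d - t) →
      (∀ i ∈ Finset.Icc (d - t) w,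
        (IntAlt.subcodeWeightSum F D i : ℝ) = IntAlt.mdsB q m w (d - t) i) ∧
      (IntAlt.subcodeCardSum F D : ℝ) = IntAlt.mdsBTotal q m w (d - t)) ∧
    -- the lower bound on the success probability
    (∀ kopt : ℕ → ℕ → ℝ,
      (∀ w ∈ Finset.Icc (d - t) t, ∀ A : Submodule F (Fin w → F),
        IntAlt.HasMinDist A (d - t) → (Module.finrank F A : ℝ) ≤ kopt w (d - t)) →
      ∀ a b c : ℕ → ℝ,
      (∀ w, a w = max 1 ((q : ℝ) ^ ((w : ℤ) - ((d : ℤ) - (t : ℤ) - 1) * (m : ℤ)))) →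
      (∀ w, b w = (q : ℝ) ^ kopt w (d - t)) →
      (∀ w, c w = ((q : ℝ) ^ m - 1) ^ w) →
      ∀ M ∈ IntAlt.interleavedCode s (IntAlt.alternantCode F α v d),
        1 - ∑ w ∈ Finset.Icc (d - t) t,
          (t.choose w : ℝ) / (((q : ℝ) ^ m - 1) * ((q : ℝ) ^ s - 1) ^ w) *
            (((q : ℝ) ^ s - 1) / ((q : ℝ) - 1) *
                (c w + IntAlt.mdsB q m w (d - t) w - IntAlt.mdsBTotal q m w (d - t)) - c w +
              ((IntAlt.mdsBTotal q m w (d - t) - c w * a w) / (b w - a w) + 1) *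
                (b w ^ s - a w ^ s) +
              c w * a w ^ s)
          ≤ IntAlt.successProb α v d M P) := by
  have hfin : FiniteDimensional F K := Module.Finite.of_finite
  have hQ : Fintype.card K = q ^ m := by rw [Module.card_eq_pow_finrank (K := F), hq, hm]
  have hδ : 1 ≤ d - t := by omega
  refine ⟨?_, ?_⟩
  · intro w _ D hD
    have hmin := (IntAlt.hasMinDist_iff.mp hD.1).2
    have hdim : Fintype.card (Fin w) + 1 ≤ Module.finrank K D + (d - t) := hD.2.ge
    refine ⟨fun i hi => ?_, ?_⟩
    · rw [IntAlt.subcodeWeightSum_eq, IntAlt.sum_card_twistedSubcode_weight hq hQ hδ hmin hdim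
        (Finset.mem_Icc.mp hi).1, Fintype.card_fin]
    · rw [IntAlt.subcodeCardSum_eq, IntAlt.sum_card_twistedSubcode hq hQ hδ hmin hdim,
        Fintype.card_fin]
  · intro kopt hkopt a b c ha hb hc M hM
    classical
    have hq1 : (1 : ℝ) < q := by rw [← hq]; exact_mod_cast Fintype.one_lt_card
    have hQ1 : (0 : ℝ) < (q : ℝ) ^ m - 1 := by
      rw [sub_pos, ← Nat.cast_pow, ← hQ]
      exact_mod_cast Fintype.one_lt_card
    have hqs : (0 : ℝ) < (q : ℝ) ^ s - 1 := sub_pos.mpr (one_lt_pow₀ hq1 hs.ne')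
    set G : ℕ → ℝ := fun w => ((q : ℝ) ^ s - 1) / ((q : ℝ) - 1) *
        (c w + IntAlt.mdsB q m w (d - t) w - IntAlt.mdsBTotal q m w (d - t)) - c w +
      ((IntAlt.mdsBTotal q m w (d - t) - c w * a w) / (b w - a w) + 1) *
        (b w ^ s - a w ^ s) + c w * a w ^ s
    have hcardP : Fintype.card P = t := by rw [Fintype.card_coe, hP]
    have hαP : Function.Injective fun j : P => α j := hα.comp Subtype.val_injective
    have hbad := IntAlt.mul_card_bad_le_sum (F := F) (s := s) (δ := d - t) hcardP hαP
      (v := fun j : P => v j) (fun j => hv j) G fun W hW => by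
        have hWt : W.card ≤ t := hcardP ▸ Finset.card_le_univ W
        refine IntAlt.sum_card_noZeroCols_le (m := m) (k := kopt W.card (d - t))
          (Fintype.card_coe W) hq hm hδ hW
          (fun x hx h0 => IntAlt.le_hammingNorm_of_mem_grsCode
            (hαP.comp Subtype.val_injective) (fun j => hv _) hx h0)
          (IntAlt.card_add_one_le_finrank_grsCode_add _ _ hδ)
          (hkopt _ (Finset.mem_Icc.mpr ⟨hW, hWt⟩)) ?_ (hb _) (hc _)
        rw [ha, Nat.cast_sub htd.le]
    rw [hq, hQ, Nat.cast_pow] at hbad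
    set bad := Finset.univ.filter fun E : Fin s → P → F => (∀ j, ∃ i, E i j ≠ 0) ∧
      ∃ x : P → K, x ≠ 0 ∧ ∀ i, (fun j => algebraMap F K (E i j) * x j) ∈
        IntAlt.grsCode (fun j : P => α j) (fun j : P => v j) (d - t)
    let all : Set (Fin s → P → F) := IntAlt.noZeroCols s P F
    let good : Set (Fin s → P → F) :=
      {E | E ∈ IntAlt.noZeroCols s P F ∧ IntAlt.DecodingSucceeds α v d M P E}
    have hall : (all.ncard : ℝ) = ((q : ℝ) ^ s - 1) ^ t := by
      have h : all = (Finset.univ.filter fun E : Fin s → P → F => ∀ j, ∃ i, E i j ≠ 0 :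
          Finset (Fin s → P → F)) := by
        rw [Finset.coe_filter_univ]
        rfl
      rw [h, Set.ncard_coe_finset, IntAlt.card_forall_exists_ne_zero, hcardP, hq, Nat.cast_pow,
        Nat.cast_sub (Nat.one_le_pow _ _ (hq ▸ Fintype.card_pos)), Nat.cast_pow, Nat.cast_one]
    -- an error matrix outside `bad` has an injective key matrix
    have hsub : all ⊆ good ∪ bad := by
      intro E hE
      by_cases hEb : E ∈ bad
      · exact Or.inr hEb
      · refine Or.inl ⟨hE, IntAlt.decodingSucceeds_of_forall hα hα0 hv hP htd hM fun x hx => ?_⟩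
        by_contra h0
        exact hEb (Finset.mem_filter.mpr ⟨Finset.mem_univ _, hE, x, h0, hx⟩)
    have hcount := (Nat.cast_le (α := ℝ)).mpr
      ((Set.ncard_le_ncard hsub (Set.toFinite _)).trans (Set.ncard_union_le _ _))
    rw [Nat.cast_add, Set.ncard_coe_finset, hall] at hcount
    change _ ≤ (good.ncard : ℝ) / all.ncard
    rw [hall, le_div_iff₀ (pow_pos hqs t), sub_mul, one_mul]
    have hsum : ((q : ℝ) ^ m - 1) * ((∑ w ∈ Finset.Icc (d - t) t,
        (t.choose w : ℝ) / (((q : ℝ) ^ m - 1) * ((q : ℝ) ^ s - 1) ^ w) * G w) *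
          ((q : ℝ) ^ s - 1) ^ t) =
        ∑ w ∈ Finset.Icc (d - t) t, (t.choose w : ℝ) * (G w * ((q : ℝ) ^ s - 1) ^ (t - w)) := by
      rw [Finset.sum_mul, Finset.mul_sum]
      refine Finset.sum_congr rfl fun w hw => ?_
      have hpow : ((q : ℝ) ^ s - 1) ^ t = ((q : ℝ) ^ s - 1) ^ w * ((q : ℝ) ^ s - 1) ^ (t - w) := by
        rw [← pow_add, Nat.add_sub_cancel' (Finset.mem_Icc.mp hw).2]
      have hw0 := (pow_pos hqs w).ne'
      rw [hpow]
      field_simp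
    have hle := le_of_mul_le_mul_left (hbad.trans_eq hsum.symm) hQ1
    linarith
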